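/- For integers $\ell\ge 5$ let $s(\ell)=t(\ell)=\lfloor \ell/\log_2 \ell\rfloor$. Define directed graphs $G_n=G_n(s,t)$ recursively. For $1\le n\le 4$, $G_n$ is a single vertex without edges. For $n\ge5$, put $m=n-s(n)-1$, and let $V(G_n)$ be the disjoint union of $V(G_m)$ and new pairwise disjoint sets $M$, $D$, $A$, $B=\{b_0,\dots,b_{t(n)-1}\}$ and $C_0,\dots,C_{t(n)-1}$ with $|M|=|C_i|=n-s(n)$, $|D|=|A|=s(n)$, $|B|=t(n)$. Write $N=M\cup D$. The edges of $G_n$ are the edges of $G_m$; all edges, in both directions, between distinct vertices of $N$, between distinct vertices of $A$, and between distinct vertices of the same $C_i$; and all edges in $N\times C_i$, $C_i\times D$, $C_i\times\{b_i\}$ (for every $i$), $B\times A$, $A\times B$, $A\times M$, $N\times V(G_m)$, $A\times V(G_m)$, $V(G_m)\times A$ and $V(G_m)\times B$. A DAG decomposition of a digraph $G$ is a finite acyclic digraph $D$ with a family of bags $B_d\subseteq V(G)$, $d\in V(D)$, such that, with $a\le b$ meaning that $b$ is reachable from $a$ in $D$ and $B_{\ge d}=\bigcup_{d\le e}B_e$: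 (1) $\bigcup_d B_d=V(G)$; (2) $B_a\cap B_c\subseteq B_b$ whenever $a<b<c$; (3) $\mathrm{Reach}_G(B_{\ge r})=B_{\ge r}$ for every root $r$ of $D$ (node without incoming edges); (4) $\mathrm{Reach}_{G-(B_a\cap B_b)}(B_{\ge b}\setminus B_a)=B_{\ge b}\setminus B_a$ for every edge $(a,b)$ of $D$. Here $\mathrm{Reach}_H(X)$ is the set of vertices reachable in $H$ from $X$. Its width is $\max_d|B_d|$, its size is $|V(D)|$, and the DAG-width $\mathrm{DAGW}(G)$ is the minimal width of a DAG decomposition of $G$. Then there is no polynomial-size DAG decomposition of $G_n$ that approximates the optimal width up to an additive constant: for every constant $c\in\mathbb N$ and every real polynomial $p$ there is an $n_0$ such that for all $n\ge n_0$, every DAG decomposition of $G_n$ of width at most $\mathrm{DAGW}(G_n)+c$ has size greater than $p(|V(G_n)|)$. -/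

import Mathlib

namespace DAGWidth

/-! ### DAG decompositions of directed graphs -/

/-- The set of vertices reachable from `S` in the digraph `G - X`
(the subgraph of `G` induced by the complement of `X`). -/
def reachAvoiding {V : Type*} (G : Digraph V) (X S : Set V) : Set V :=
  {v | ∃ u ∈ S, u ∉ X ∧
    Relation.ReflTransGen (fun a b => G.Adj a b ∧ a ∉ X ∧ b ∉ X) u v}

/-- The set of vertices reachable from `S` in the digraph `G`. -/
def reach {V : Type*} (G : Digraph V) (S : Set V) : Set V :=
  {v | ∃ u ∈ S, Relation.ReflTransGen G.Adj u v}

/-- `above D B r` is the union of the bags `B d` over all `d` reachable from `r` in `D`. -/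
def above {V I : Type*} (D : Digraph I) (B : I → Finset V) (r : I) : Set V :=
  {v | ∃ d, Relation.ReflTransGen D.Adj r d ∧ v ∈ B d}

/-- A DAG decomposition of a digraph `G`: a finite acyclic digraph `dag` together with a bag
of vertices of `G` for each of its nodes. The order on the nodes is reachability:
`a < b` is `Relation.TransGen dag.Adj a b` and `a ≤ b` is `Relation.ReflTransGen dag.Adj a b`. -/
structure DAGDecomposition {V : Type*} (G : Digraph V) where
  node : Type
  [fintypeNode : Fintype node]
  dag : Digraph node
  acyclic : ∀ d, ¬ Relation.TransGen dag.Adj d d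
  bag : node → Finset V
  /-- The bags cover all vertices. -/
  cover : ∀ v : V, ∃ d, v ∈ bag d
  /-- If `a < b < c`, then `B a ∩ B c ⊆ B b`. -/
  connected : ∀ a b c, Relation.TransGen dag.Adj a b → Relation.TransGen dag.Adj b c →
    ∀ v, v ∈ bag a → v ∈ bag c → v ∈ bag b
  /-- What lies above a root (a node without incoming edges) is closed under reachability. -/
  root_closed : ∀ r, (∀ d, ¬ dag.Adj d r) →
    reach G (above dag bag r) = above dag bag r
  /-- For each edge `(a, b)` of the DAG, `B a ∩ B b` guards what lies above `b` outside `B a`. -/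
  edge_guarded : ∀ a b, dag.Adj a b →
    reachAvoiding G ((bag a : Set V) ∩ (bag b : Set V)) (above dag bag b \ (bag a : Set V)) =
      above dag bag b \ (bag a : Set V)

attribute [instance] DAGDecomposition.fintypeNode

/-- The width of a DAG decomposition: the maximal number of vertices in a bag. -/
def DAGDecomposition.width {V : Type*} {G : Digraph V} (D : DAGDecomposition G) : ℕ :=
  Finset.univ.sup fun d : D.node => (D.bag d).card

/-- The size of a DAG decomposition: the number of nodes of its DAG. -/
def DAGDecomposition.size {V : Type*} {G : Digraph V} (D : DAGDecomposition G) : ℕ :=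
  Fintype.card D.node

/-- The DAG-width of `G`: the minimal width of a DAG decomposition of `G`. -/
noncomputable def dagWidth {V : Type*} (G : Digraph V) : ℕ :=
  sInf (Set.range fun D : DAGDecomposition G => D.width)

/-- The decomposition with a single bag. In particular, for a finite digraph the minimum in
the definition of the DAG-width is over a nonempty set. -/
def DAGDecomposition.trivial {V : Type*} [Fintype V] (G : Digraph V) : DAGDecomposition G where
  node := Unit
  dag := ⟨fun _ _ => False⟩
  acyclic := by
    intro d h
    induction h with
    | single h => exact h
    | tail _ h _ => exact h
  bag := fun _ => Finset.univ
  cover := fun v => ⟨(), Finset.mem_univ v⟩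
  connected := fun _ _ _ _ _ v _ _ => Finset.mem_univ v
  root_closed := by
    intro r _
    ext v
    constructor
    · intro _
      exact ⟨r, Relation.ReflTransGen.refl, Finset.mem_univ v⟩
    · intro hv
      exact ⟨v, hv, Relation.ReflTransGen.refl⟩
  edge_guarded := fun _ _ h => h.elim

/-! ### The digraphs `G_n(s,t)` -/

/-- Names for the vertices of the digraphs `G_n(s,t)`. Except for the single vertex `base` of the
graphs with index at most `4`, the first argument is the level of the vertex. -/
inductive Vertex : Type
  | base : Vertex
  | M (level j : ℕ) : Vertex
  | D (level j : ℕ) : Vertex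
  | C (level i j : ℕ) : Vertex
  | A (level j : ℕ) : Vertex
  | B (level i : ℕ) : Vertex
  deriving DecidableEq

/-- `M(n)`, with `n - s(n)` elements. -/
def setM (s : ℕ → ℕ) (n : ℕ) : Finset Vertex := (Finset.range (n - s n)).image (Vertex.M n)

/-- `D^s(n)`, with `s(n)` elements. -/
def setD (s : ℕ → ℕ) (n : ℕ) : Finset Vertex := (Finset.range (s n)).image (Vertex.D n)

/-- `N(n) = M(n) ∪ D^s(n)`. -/
def setN (s : ℕ → ℕ) (n : ℕ) : Finset Vertex := setM s n ∪ setD s n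

/-- `C_i(n)`, with `n - s(n)` elements. -/
def setC (s : ℕ → ℕ) (n i : ℕ) : Finset Vertex := (Finset.range (n - s n)).image (Vertex.C n i)

/-- `A^s(n)`, with `s(n)` elements. -/
def setA (s : ℕ → ℕ) (n : ℕ) : Finset Vertex := (Finset.range (s n)).image (Vertex.A n)

/-- `B^t(n) = {b_0(n), …, b_{t(n)-1}(n)}`. -/
def setB (t : ℕ → ℕ) (n : ℕ) : Finset Vertex := (Finset.range (t n)).image (Vertex.B n)

/-- The vertex set of `G_n(s,t)`. -/
def vertices (s t : ℕ → ℕ) (n : ℕ) : Finset Vertex :=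
  if n < 5 then {Vertex.base}
  else vertices s t (n - s n - 1) ∪ setA s n ∪ setB t n ∪
    (Finset.range (t n)).biUnion (fun i => setC s n i) ∪ setN s n
termination_by n
decreasing_by omega

/-- The edge set of `G_n(s,t)`. -/
def edges (s t : ℕ → ℕ) (n : ℕ) : Finset (Vertex × Vertex) :=
  if n < 5 then ∅
  else
    edges s t (n - s n - 1) ∪ (setN s n).offDiag ∪
      (Finset.range (t n)).biUnion (fun i => (setC s n i).offDiag) ∪ (setA s n).offDiag ∪
    (Finset.range (t n)).biUnion (fun i =>
      (setN s n ×ˢ setC s n i) ∪ (setC s n i ×ˢ setD s n) ∪ (setC s n i ×ˢ {Vertex.B n i})) ∪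
    (setB t n ×ˢ setA s n) ∪ (setA s n ×ˢ setB t n) ∪ (setA s n ×ˢ setM s n) ∪
    (setN s n ×ˢ vertices s t (n - s n - 1)) ∪ (setA s n ×ˢ vertices s t (n - s n - 1)) ∪
    (vertices s t (n - s n - 1) ×ˢ setA s n) ∪ (vertices s t (n - s n - 1) ×ˢ setB t n)
termination_by n
decreasing_by omega

/-- The digraph `G_n(s,t)`. -/
def graph (s t : ℕ → ℕ) (n : ℕ) : Digraph {v : Vertex // v ∈ vertices s t n} :=
  ⟨fun u v => (u.1, v.1) ∈ edges s t n⟩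

/-- The function `ℓ ↦ ⌊ℓ / log ℓ⌋` (binary logarithm), used for both parameters `s` and `t`. -/
noncomputable def levelParam (l : ℕ) : ℕ := ⌊(l : ℝ) / Real.logb 2 (l : ℝ)⌋₊

end DAGWidth

namespace DAGWidth

/-! ### Building DAG decompositions from the leaves to the root -/

/-! A DAG decomposition is read as a strategy for cops who occupy the current bag and chase a robber
monotonically, that is, without ever giving back a vertex to him. The theorem combines an upper
bound for the width with a lower bound for the number of bags.

Width: `n + 1` cops suffice (`dagWidth_graph_le`), so the decompositions in question have width at
most `n + 1 + c`. No lower bound for the DAG-width is needed.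

Size: the robber fixes in advance an index `i` at each of the `k` outermost levels. After the cops
have filled `N` at a level, he uses `C_i` to force them onto `b_i`, then `A` to force them onto `A`,
and moves on to the next inner copy while all these vertices stay occupied
(`Pursuit.exists_next_level`). So for every choice of indices some bag contains the chosen `b_i`,
the sets `A` of the outer levels and the innermost `N` (`exists_node_guards`). These are exactly `n`
vertices. Only `c + 1` places of the bag remain, so at most `2 ^ (c + 1)` choices share a bag, and
there are at least `T ^ k / 2 ^ (c + 1)` bags if each of these levels offers at least `T` indices
(`pow_le_size`).

For fixed `k` and large `n` one can take `T` to be at least the square root of `n`, because `ℓ / log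
ℓ` outgrows the square root. As `G_n` has at most `n ^ 3 + 1` vertices, a suitable constant depth
`k` beats any given polynomial. -/

theorem reachAvoiding_eq_self {V : Type*} {G : Digraph V} {X S : Set V}
    (hX : ∀ u ∈ S, u ∉ X) (hS : ∀ u ∈ S, ∀ v, G.Adj u v → v ∉ X → v ∈ S) :
    reachAvoiding G X S = S := by
  ext v
  constructor
  · rintro ⟨u, hu, -, h⟩
    induction h with
    | refl => exact hu
    | tail _ h ih => exact hS _ ih _ h.1 h.2.2
  · exact fun hv => ⟨v, hv, hX v hv, .refl⟩

/-- A DAG decomposition with a single root with bag `W`, with bags of size at most `k` and with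
union `S` of all bags, where nothing is required of the vertices reachable from `S`. -/
def HasRootedDecomposition {V : Type*} (G : Digraph V) (k : ℕ) (W : Finset V) (S : Set V) :
    Prop :=
  ∃ (I : Type) (_ : Fintype I) (dag : Digraph I) (bag : I → Finset V) (r : I),
    (∀ d, ¬ Relation.TransGen dag.Adj d d) ∧
    (∀ a b c, Relation.TransGen dag.Adj a b → Relation.TransGen dag.Adj b c →
      ∀ v, v ∈ bag a → v ∈ bag c → v ∈ bag b) ∧
    (∀ a b, dag.Adj a b →
      reachAvoiding G ((bag a : Set V) ∩ (bag b : Set V)) (above dag bag b \ (bag a : Set V)) =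
        above dag bag b \ (bag a : Set V)) ∧
    (∀ d, Relation.ReflTransGen dag.Adj r d) ∧ (∀ d, (bag d).card ≤ k) ∧
    bag r = W ∧ above dag bag r = S

theorem HasRootedDecomposition.exists_width_le {V : Type*} {G : Digraph V} {k : ℕ}
    {W : Finset V} (h : HasRootedDecomposition G k W Set.univ) :
    ∃ D : DAGDecomposition G, D.width ≤ k := by
  obtain ⟨I, _, dag, bag, r, hac, hconn, hedge, hr, hk, -, hS⟩ := h
  refine ⟨⟨I, dag, hac, bag, fun v => ?_, hconn, fun d hd => ?_, hedge⟩, ?_⟩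
  · obtain ⟨d, -, hd⟩ : v ∈ above dag bag r := hS ▸ Set.mem_univ v
    exact ⟨d, hd⟩
  · obtain rfl : d = r := by
      rcases Relation.ReflTransGen.cases_tail (hr d) with h | ⟨e, -, h⟩
      · exact h
      · exact (hd e h).elim
    rw [hS]
    ext v
    exact ⟨fun _ => Set.mem_univ v, fun hv => ⟨v, hv, .refl⟩⟩
  · exact Finset.sup_le fun d _ => hk d

/-- The digraph obtained from a family of rooted digraphs by adding a new root below them. -/
def joinDag {ι : Type} {I : ι → Type} (dag : ∀ i, Digraph (I i)) (r : ∀ i, I i) :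
    Digraph (Option (Σ i, I i)) :=
  ⟨fun x y => match x, y with
    | none, some y => y.2 = r y.1
    | some x, some y => ∃ h : x.1 = y.1, (dag y.1).Adj (h ▸ x.2) y.2
    | _, none => False⟩

section joinDag

variable {ι : Type} {I : ι → Type} {dag : ∀ i, Digraph (I i)} {r : ∀ i, I i}

theorem joinDag_adj_none {x : Option (Σ i, I i)} : ¬ (joinDag dag r).Adj x none := by
  cases x <;> exact id

theorem joinDag_none_adj {y : Option (Σ i, I i)} :
    (joinDag dag r).Adj none y ↔ ∃ i, y = some ⟨i, r i⟩ := by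
  rcases y with _ | ⟨i, y⟩
  · exact ⟨False.elim, by simp⟩
  · constructor
    · intro h
      exact ⟨i, by rw [show y = r i from h]⟩
    · rintro ⟨j, hj⟩
      cases hj
      rfl

theorem joinDag_some_adj {i : ι} {x : I i} {y : Option (Σ i, I i)} :
    (joinDag dag r).Adj (some ⟨i, x⟩) y ↔ ∃ z, y = some ⟨i, z⟩ ∧ (dag i).Adj x z := by
  rcases y with _ | ⟨j, y⟩
  · exact ⟨False.elim, by simp⟩
  · constructor
    · rintro ⟨h, h'⟩
      dsimp only at h
      subst h
      exact ⟨y, rfl, h'⟩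
    · rintro ⟨z, hz, h⟩
      cases hz
      exact ⟨rfl, h⟩

theorem joinDag_some_transGen {i : ι} {x : I i} {y : Option (Σ i, I i)} :
    Relation.TransGen (joinDag dag r).Adj (some ⟨i, x⟩) y ↔
      ∃ z, y = some ⟨i, z⟩ ∧ Relation.TransGen (dag i).Adj x z := by
  constructor
  · intro h
    induction h with
    | single h =>
      obtain ⟨z, rfl, h'⟩ := joinDag_some_adj.1 h
      exact ⟨z, rfl, .single h'⟩
    | tail _ h ih =>
      obtain ⟨z, rfl, h'⟩ := ih
      obtain ⟨w, rfl, h''⟩ := joinDag_some_adj.1 h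
      exact ⟨w, rfl, h'.tail h''⟩
  · rintro ⟨z, rfl, h⟩
    exact h.lift (fun z => (some ⟨i, z⟩ : Option (Σ i, I i)))
      fun a b h => joinDag_some_adj.2 ⟨b, rfl, h⟩

theorem joinDag_some_reflTransGen {i : ι} {x : I i} {y : Option (Σ i, I i)} :
    Relation.ReflTransGen (joinDag dag r).Adj (some ⟨i, x⟩) y ↔
      ∃ z, y = some ⟨i, z⟩ ∧ Relation.ReflTransGen (dag i).Adj x z := by
  simp only [Relation.reflTransGen_iff_eq_or_transGen, joinDag_some_transGen]
  constructor
  · rintro (rfl | ⟨z, rfl, h⟩)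
    exacts [⟨x, rfl, .inl rfl⟩, ⟨z, rfl, .inr h⟩]
  · rintro ⟨z, rfl, rfl | h⟩
    exacts [.inl rfl, .inr ⟨z, rfl, h⟩]

theorem not_joinDag_transGen_none {x : Option (Σ i, I i)} :
    ¬ Relation.TransGen (joinDag dag r).Adj x none := by
  intro h
  obtain ⟨y, -, h⟩ := Relation.TransGen.tail'_iff.1 h
  exact joinDag_adj_none h

theorem above_joinDag_some {V : Type*} {W : Finset V} {bag : ∀ i, I i → Finset V} {i : ι}
    {x : I i} :
    above (joinDag dag r) (fun y => y.elim W fun y => bag y.1 y.2) (some ⟨i, x⟩) =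
      above (dag i) (bag i) x := by
  ext v
  constructor
  · rintro ⟨d, hd, hv⟩
    obtain ⟨z, rfl, h⟩ := joinDag_some_reflTransGen.1 hd
    exact ⟨z, h, hv⟩
  · rintro ⟨z, h, hv⟩
    exact ⟨some ⟨i, z⟩, joinDag_some_reflTransGen.2 ⟨z, rfl, h⟩, hv⟩

end joinDag

/-- By `hSW`, whatever a child shares with `W` already lies in the root bag of the child, so
connectivity inside the child extends to the new root. By `hS`, the robber can leave `S i` only from
`W`, so the new edges are guarded. The children are kept as disjoint copies even if their bags
overlap: only the width matters for the upper bound. -/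
theorem HasRootedDecomposition.join {V : Type*} {G : Digraph V} {k : ℕ} {W : Finset V}
    (hW : W.card ≤ k) {ι : Type} [Finite ι] {W' : ι → Finset V} {S : ι → Set V}
    (h : ∀ i, HasRootedDecomposition G k (W' i) (S i))
    (hSW : ∀ i, ∀ v ∈ S i, v ∈ W → v ∈ W' i)
    (hS : ∀ i, ∀ u ∈ S i, u ∉ W → ∀ v, G.Adj u v → v ∈ S i) :
    HasRootedDecomposition G k W {v | v ∈ W ∨ ∃ i, v ∈ S i} := by
  have := Fintype.ofFinite ι
  choose I hI dag bag r hac hconn hedge hr hk hbag habove using h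
  have hnone : ∀ i d, Relation.ReflTransGen (joinDag dag r).Adj none (some ⟨i, d⟩) := fun i d =>
    .head (joinDag_none_adj.2 ⟨i, rfl⟩) (joinDag_some_reflTransGen.2 ⟨d, rfl, hr i d⟩)
  refine ⟨Option (Σ i, I i), inferInstance, joinDag dag r,
    fun y => y.elim W fun y => bag y.1 y.2, none, ?_, ?_, ?_, ?_, ?_, rfl, ?_⟩
  · rintro (_ | ⟨i, d⟩) h
    · exact not_joinDag_transGen_none h
    · obtain ⟨z, hz, h⟩ := joinDag_some_transGen.1 h
      cases hz
      exact hac i d h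
  · rintro a (_ | ⟨i, b⟩) c hab hbc v hva hvc
    · exact (not_joinDag_transGen_none hab).elim
    obtain ⟨c, rfl, hbc'⟩ := joinDag_some_transGen.1 hbc
    rcases a with _ | ⟨j, a⟩
    · have hvS : v ∈ S i := habove i ▸ ⟨c, hr i c, hvc⟩
      have hvr : v ∈ bag i (r i) := hbag i ▸ hSW i v hvS hva
      rcases Relation.reflTransGen_iff_eq_or_transGen.1 (hr i b) with rfl | hb
      · exact hvr
      · exact hconn i _ _ _ hb hbc' v hvr hvc
    · obtain ⟨z, hz, hab⟩ := joinDag_some_transGen.1 hab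
      cases hz
      exact hconn i _ _ _ hab hbc' v hva hvc
  · rintro (_ | ⟨i, a⟩) b hab
    · obtain ⟨i, rfl⟩ := joinDag_none_adj.1 hab
      rw [above_joinDag_some, habove]
      refine reachAvoiding_eq_self (fun u hu hu' => hu.2 hu'.1) fun u hu v huv hv => ?_
      have hvS := hS i u hu.1 hu.2 v huv
      exact ⟨hvS, fun hvW => hv ⟨hvW, by simpa [hbag] using hSW i v hvS hvW⟩⟩
    · obtain ⟨z, rfl, hab'⟩ := joinDag_some_adj.1 hab
      rw [above_joinDag_some]
      exact hedge i a z hab'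
  · rintro (_ | ⟨i, d⟩)
    exacts [.refl, hnone i d]
  · rintro (_ | ⟨i, d⟩)
    exacts [hW, hk i d]
  · ext v
    constructor
    · rintro ⟨_ | ⟨i, d⟩, -, hv⟩
      · exact .inl hv
      · exact .inr ⟨i, habove i ▸ ⟨d, hr i d, hv⟩⟩
    · rintro (hv | ⟨i, hv⟩)
      · exact ⟨none, .refl, hv⟩
      · obtain ⟨d, -, hv⟩ := (habove i).symm ▸ hv
        exact ⟨some ⟨i, d⟩, hnone i d, hv⟩

theorem HasRootedDecomposition.join₂ {V : Type*} {G : Digraph V} {k : ℕ} {W W₁ W₂ : Finset V}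
    {S₁ S₂ : Set V} (hW : W.card ≤ k) (h₁ : HasRootedDecomposition G k W₁ S₁)
    (h₂ : HasRootedDecomposition G k W₂ S₂) (hSW₁ : ∀ v ∈ S₁, v ∈ W → v ∈ W₁)
    (hSW₂ : ∀ v ∈ S₂, v ∈ W → v ∈ W₂) (hS₁ : ∀ u ∈ S₁, u ∉ W → ∀ v, G.Adj u v → v ∈ S₁)
    (hS₂ : ∀ u ∈ S₂, u ∉ W → ∀ v, G.Adj u v → v ∈ S₂) :
    HasRootedDecomposition G k W {v | v ∈ W ∨ v ∈ S₁ ∨ v ∈ S₂} := by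
  convert HasRootedDecomposition.join hW (ι := Bool) (W' := fun x => bif x then W₂ else W₁)
    (S := fun x => bif x then S₂ else S₁) (Bool.rec h₁ h₂) (Bool.rec hSW₁ hSW₂)
    (Bool.rec hS₁ hS₂) using 1
  ext v
  simp

theorem HasRootedDecomposition.leaf {V : Type*} {G : Digraph V} {k : ℕ} {W : Finset V}
    (hW : W.card ≤ k) : HasRootedDecomposition G k W W := by
  simpa using HasRootedDecomposition.join (G := G) hW (ι := Empty) (W' := nofun) (S := nofun)
    (fun i => i.elim) (fun i => i.elim) (fun i => i.elim)

/-! ### The pursuit of a robber along a DAG decomposition -/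

/-- A positional pursuit in the digraph `G`: in position `p` the vertices of `bag p` are occupied
and the robber can be anywhere in `terr p`. -/
structure Pursuit {V : Type*} (G : Digraph V) (P : Type*) where
  bag : P → Finset V
  terr : P → Set V
  step : P → P → Prop
  wf : WellFounded (flip step)
  not_mem_bag : ∀ p, ∀ v ∈ terr p, v ∉ bag p
  exists_step : ∀ p, ∀ v ∈ terr p, ∃ q, step p q ∧ ∀ u,
    Relation.ReflTransGen (fun a b => G.Adj a b ∧ ¬ (b ∈ bag p ∧ b ∈ bag q)) v u →
      u ∉ bag p ∧ (u ∉ bag q → u ∈ terr q)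

theorem above_step {V : Type*} {G : Digraph V} (D : DAGDecomposition G) {d : D.node} {v : V}
    (hv : v ∈ above D.dag D.bag d) (hd : v ∉ D.bag d) :
    ∃ e, D.dag.Adj d e ∧ v ∈ above D.dag D.bag e := by
  obtain ⟨f, hf, hvf⟩ := hv
  rcases Relation.ReflTransGen.cases_head hf with rfl | ⟨e, he, hf⟩
  · exact (hd hvf).elim
  · exact ⟨e, he, f, hf, hvf⟩

theorem DAGDecomposition.wellFounded {V : Type*} {G : Digraph V} (D : DAGDecomposition G) :
    WellFounded (Relation.TransGen D.dag.Adj) :=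
  have : IsTrans D.node (Relation.TransGen D.dag.Adj) := ⟨fun _ _ _ => .trans⟩
  have : Std.Irrefl (Relation.TransGen D.dag.Adj) := ⟨D.acyclic⟩
  Finite.wellFounded_of_trans_of_irrefl _

theorem DAGDecomposition.wellFounded_flip {V : Type*} {G : Digraph V} (D : DAGDecomposition G) :
    WellFounded (flip D.dag.Adj) :=
  have : IsTrans D.node (flip (Relation.TransGen D.dag.Adj)) := ⟨fun _ _ _ h h' => h'.trans h⟩
  have : Std.Irrefl (flip (Relation.TransGen D.dag.Adj)) := ⟨D.acyclic⟩
  Subrelation.wf (r := flip (Relation.TransGen D.dag.Adj)) (fun h => Relation.TransGen.single h)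
    (Finite.wellFounded_of_trans_of_irrefl _)

theorem DAGDecomposition.exists_root {V : Type*} {G : Digraph V} (D : DAGDecomposition G)
    (d : D.node) : ∃ r, (∀ e, ¬ D.dag.Adj e r) ∧ Relation.ReflTransGen D.dag.Adj r d := by
  induction d using D.wellFounded.induction with
  | _ d ih =>
    by_cases h : ∃ e, D.dag.Adj e d
    · obtain ⟨e, he⟩ := h
      obtain ⟨r, hr, hre⟩ := ih e (.single he)
      exact ⟨r, hr, hre.tail he⟩
    · exact ⟨d, not_exists.1 h, .refl⟩

/-- The pursuit given by a DAG decomposition. In the additional initial position `none`, no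
vertex is occupied. -/
def DAGDecomposition.pursuit {V : Type*} {G : Digraph V} (D : DAGDecomposition G) :
    Pursuit G (Option D.node) where
  bag p := p.elim ∅ D.bag
  terr p := p.elim Set.univ fun d => above D.dag D.bag d \ D.bag d
  step p q := match p, q with
    | none, some r => ∀ e, ¬ D.dag.Adj e r
    | some d, some e => D.dag.Adj d e
    | _, none => False
  wf := by
    have hsome : ∀ d, Acc (flip (α := Option D.node) fun p q => match p, q with
        | none, some r => ∀ e, ¬ D.dag.Adj e r
        | some d, some e => D.dag.Adj d e
        | _, none => False) (some d) := by
      intro d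
      induction d using D.wellFounded_flip.induction with
      | _ d ih =>
        refine ⟨_, ?_⟩
        rintro (_ | e) h
        · exact h.elim
        · exact ih e h
    refine ⟨?_⟩
    rintro (_ | d)
    · refine ⟨_, ?_⟩
      rintro (_ | e) h
      · exact h.elim
      · exact hsome e
    · exact hsome d
  not_mem_bag := by
    rintro (_ | d) v hv
    · simp
    · exact hv.2
  exists_step := by
    rintro (_ | d) v hv
    · obtain ⟨d, hd⟩ := D.cover v
      obtain ⟨r, hr, hrd⟩ := D.exists_root d
      refine ⟨some r, hr, fun u hu => ⟨by simp, fun hur => ⟨?_, hur⟩⟩⟩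
      rw [← D.root_closed r hr]
      exact ⟨v, ⟨d, hrd, hd⟩, hu.lift id fun _ _ h => h.1⟩
    · obtain ⟨e, he, hve⟩ := above_step D hv.1 hv.2
      refine ⟨some e, he, fun u hu => ?_⟩
      have key : u ∈ above D.dag D.bag e \ (D.bag d : Set V) := by
        rw [← D.edge_guarded d e he]
        refine ⟨v, ⟨hve, hv.2⟩, fun h => hv.2 h.1, ?_⟩
        -- A run restricts only the targets of its steps; since it starts outside `D.bag d`, its
        -- sources avoid the guarded set as well.
        have : ∀ u, Relation.ReflTransGen (fun a b => G.Adj a b ∧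
            ¬ (b ∈ D.bag d ∧ b ∈ D.bag e)) v u → ¬ (u ∈ D.bag d ∧ u ∈ D.bag e) ∧
            Relation.ReflTransGen (fun a b => G.Adj a b ∧
              a ∉ (D.bag d : Set V) ∩ (D.bag e : Set V) ∧
              b ∉ (D.bag d : Set V) ∩ (D.bag e : Set V)) v u := by
          intro u hu
          induction hu with
          | refl => exact ⟨fun h => hv.2 h.1, .refl⟩
          | tail _ h ih => exact ⟨h.2, ih.2.tail ⟨h.1, ih.1, h.2⟩⟩
        exact (this u hu).2
      exact ⟨key.2, fun h => ⟨key.1, h⟩⟩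

/-! ### The robber's strategy against a pursuit -/

namespace Pursuit

variable {V : Type*} {G : Digraph V} {P : Type*} (S : Pursuit G P)

/-- The vertices that the robber can reach from `v` while the pursuit moves from `p` to `q`. -/
def CanRun (p q : P) (v u : V) : Prop :=
  Relation.ReflTransGen (fun a b => G.Adj a b ∧ ¬ (b ∈ S.bag p ∧ b ∈ S.bag q)) v u

/-- The robber at `v` can be pursued by a move from `p` to `q`. -/
def IsMove (p q : P) (v : V) : Prop :=
  S.step p q ∧ ∀ u, S.CanRun p q v u → u ∉ S.bag p ∧ (u ∉ S.bag q → u ∈ S.terr q)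

variable {S}

/-- A pursuit is well-founded, so the robber cannot maintain an invariant forever. His strategies
are stated as invariants whose only exit is `goal`. -/
theorem chase {goal : Prop} (Inv : P → V → Prop) (hInv : ∀ p v, Inv p v → v ∈ S.terr p)
    (h : ∀ p q v, Inv p v → S.IsMove p q v → goal ∨ ∃ u, Inv q u) {p : P} {v : V}
    (hp : Inv p v) : goal := by
  induction p using S.wf.induction generalizing v with
  | _ p ih =>
    obtain ⟨q, hq, hmove⟩ := S.exists_step p v (hInv p v hp)
    rcases h p q v hp ⟨hq, hmove⟩ with hg | ⟨u, hu⟩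
    · exact hg
    · exact ih q hq hu

/-- Only vertices held both before and after a move block the robber, so it is enough that the
target is missing from one of the two bags. -/
theorem CanRun.step_right {p q : P} {v u w : V} (h : S.CanRun p q v u) (huw : G.Adj u w)
    (hw : w ∉ S.bag q) : S.CanRun p q v w :=
  h.tail ⟨huw, fun h => hw h.2⟩

theorem CanRun.step_left {p q : P} {v u w : V} (h : S.CanRun p q v u) (huw : G.Adj u w)
    (hw : w ∉ S.bag p) : S.CanRun p q v w :=
  h.tail ⟨huw, fun h => hw h.1⟩

theorem IsMove.mem_terr {p q : P} {v u : V} (h : S.IsMove p q v) (hu : S.CanRun p q v u)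
    (huq : u ∉ S.bag q) : u ∈ S.terr q :=
  (h.2 u hu).2 huq

/-- A vertex that would be within reach of the robber stays occupied. -/
theorem IsMove.mem_bag {p q : P} {v u w : V} (h : S.IsMove p q v) (hu : S.CanRun p q v u)
    (huw : G.Adj u w) (hw : w ∈ S.bag p) : w ∈ S.bag q := by
  by_contra hwq
  exact (h.2 w (hu.step_right huw hwq)).1 hw

/-- If the robber is in a clique `N`, then `N` is occupied at some time, and until then all
vertices of `X` remain occupied, if there are edges from all vertices of `N` to them. -/
theorem exists_clique_subset_bag {X N : Set V} (hN : ∀ u ∈ N, ∀ v ∈ N, u ≠ v → G.Adj u v)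
    (hNX : ∀ u ∈ N, ∀ v ∈ X, G.Adj u v) {p : P} {v : V} (hv : v ∈ S.terr p) (hvN : v ∈ N)
    (hX : ∀ x ∈ X, x ∈ S.bag p) :
    ∃ p q, ∃ v ∈ N, v ∈ S.terr p ∧ S.IsMove p q v ∧ (∀ x ∈ X, x ∈ S.bag p) ∧
      (∀ x ∈ X, x ∈ S.bag q) ∧ ∀ x ∈ N, x ∈ S.bag q := by
  refine chase (S := S) (fun p v => v ∈ S.terr p ∧ v ∈ N ∧ ∀ x ∈ X, x ∈ S.bag p)
    (fun _ _ h => h.1) ?_ ⟨hv, hvN, hX⟩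
  rintro p q v ⟨hv, hvN, hX⟩ hm
  have hXq : ∀ x ∈ X, x ∈ S.bag q := fun x hx => hm.mem_bag .refl (hNX v hvN x hx) (hX x hx)
  by_cases hNq : ∀ x ∈ N, x ∈ S.bag q
  · exact .inl ⟨p, q, v, hvN, hv, hm, hX, hXq, hNq⟩
  · push Not at hNq
    obtain ⟨u, hu, huq⟩ := hNq
    refine .inr ⟨u, ?_, hu, hXq⟩
    rcases eq_or_ne v u with rfl | hne
    · exact hm.mem_terr .refl huq
    · exact hm.mem_terr (CanRun.step_right .refl (hN v hvN u hu hne) huq) huq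

/-- The pursuit through one level of the digraphs `G_n(s,t)`: from a position where `X` is
occupied and the robber is in `M ∪ D`, the robber reaches a position where `X`, `A` and `b` are
occupied and the robber is in `N'`. -/
theorem exists_next_level {X M D C A N' : Set V} {b : V}
    (hN : ∀ u ∈ M ∪ D, ∀ v ∈ M ∪ D, u ≠ v → G.Adj u v)
    (hC : ∀ u ∈ C, ∀ v ∈ C, u ≠ v → G.Adj u v) (hA : ∀ u ∈ A, ∀ v ∈ A, u ≠ v → G.Adj u v)
    (hNX : ∀ u ∈ M ∪ D, ∀ v ∈ X, G.Adj u v) (hNC : ∀ u ∈ M ∪ D, ∀ v ∈ C, G.Adj u v)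
    (hNN' : ∀ u ∈ M ∪ D, ∀ v ∈ N', G.Adj u v) (hCD : ∀ u ∈ C, ∀ v ∈ D, G.Adj u v)
    (hCb : ∀ u ∈ C, G.Adj u b) (hbA : ∀ u ∈ A, G.Adj b u) (hAM : ∀ u ∈ A, ∀ v ∈ M, G.Adj u v)
    (hAX : ∀ u ∈ A, ∀ v ∈ X, G.Adj u v) (hAb : ∀ u ∈ A, G.Adj u b)
    (hAN' : ∀ u ∈ A, ∀ v ∈ N', G.Adj u v) (hN'A : ∀ u ∈ N', ∀ v ∈ A, G.Adj u v)
    (hfreeC : ∀ p, (∀ x ∈ X ∪ (M ∪ D), x ∈ S.bag p) → ∃ u ∈ C, u ∉ S.bag p)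
    (hfreeA : ∀ p, (∀ x ∈ X ∪ (M ∪ D), x ∈ S.bag p) → ∃ u ∈ A, u ∉ S.bag p)
    (hfreeN : ∀ p, (∀ x ∈ X ∪ (M ∪ D), x ∈ S.bag p) → ∃ u ∈ N', u ∉ S.bag p)
    (hfreeM : ∀ p, (∀ x ∈ X ∪ (M ∪ A), x ∈ S.bag p) → ∃ u ∈ N', u ∉ S.bag p)
    {p : P} {v : V} (hv : v ∈ S.terr p) (hvN : v ∈ M ∪ D) (hX : ∀ x ∈ X, x ∈ S.bag p) :
    ∃ p, ∃ v ∈ N', v ∈ S.terr p ∧ (∀ x ∈ X, x ∈ S.bag p) ∧ (∀ x ∈ A, x ∈ S.bag p) ∧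
      b ∈ S.bag p := by
  -- From `A` the robber threatens `X`, `M` and `b`, which therefore stay occupied until `A` is
  -- full; only `D` may be released. Then he moves to a free vertex of `N'`.
  have inA : ∀ p, ∀ v ∈ A, v ∈ S.terr p → (∀ x ∈ X ∪ (M ∪ D), x ∈ S.bag p) → b ∈ S.bag p →
      ∃ p, ∃ v ∈ N', v ∈ S.terr p ∧ (∀ x ∈ X, x ∈ S.bag p) ∧ (∀ x ∈ A, x ∈ S.bag p) ∧
      b ∈ S.bag p := by
    intro p v hvA hv hX hb
    obtain ⟨p, q, v, hvA, hv, hm, hXp, hXq, hAq⟩ := exists_clique_subset_bag (S := S)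
      (X := X ∪ (M ∪ {b})) hA (by
        rintro u hu x (hx | hx | rfl)
        exacts [hAX u hu x hx, hAM u hu x hx, hAb u hu]) hv hvA (by
        rintro x (hx | hx | rfl)
        exacts [hX x (.inl hx), hX x (.inr (.inl hx)), hb])
    obtain ⟨w, hw, hwq⟩ := hfreeM q (by
      rintro x (hx | hx | hx)
      exacts [hXq x (.inl hx), hXq x (.inr (.inl hx)), hAq x hx])
    exact ⟨q, w, hw, hm.mem_terr (CanRun.step_right .refl (hAN' v hvA w hw) hwq) hwq,
      fun x hx => hXq x (.inl hx), hAq, hXq b (.inr (.inr rfl))⟩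
  have inC : ∀ p, ∀ v ∈ C, v ∈ S.terr p → (∀ x ∈ X ∪ (M ∪ D), x ∈ S.bag p) → b ∉ S.bag p →
      ∃ p, ∃ v ∈ N', v ∈ S.terr p ∧ (∀ x ∈ X, x ∈ S.bag p) ∧ (∀ x ∈ A, x ∈ S.bag p) ∧
      b ∈ S.bag p := by
    intro p v hvC hv hX hb
    refine chase (S := S) (fun p v => v ∈ S.terr p ∧ v ∈ C ∧ (∀ x ∈ X ∪ (M ∪ D), x ∈ S.bag p) ∧
      b ∉ S.bag p) (fun _ _ h => h.1) ?_ ⟨hv, hvC, hX, hb⟩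
    rintro p q v ⟨hv, hvC, hX, hb⟩ hm
    -- Since `b` is missing from the old bag, the robber can pass through it even during the move
    -- that occupies it.
    have hrun : S.CanRun p q v b := CanRun.step_left .refl (hCb v hvC) hb
    obtain ⟨a, ha, hap⟩ := hfreeA p hX
    have hruna := hrun.step_left (hbA a ha) hap
    have hXq : ∀ x ∈ X ∪ (M ∪ D), x ∈ S.bag q := by
      rintro x (hx | hx | hx)
      · exact hm.mem_bag hruna (hAX a ha x hx) (hX x (.inl hx))
      · exact hm.mem_bag hruna (hAM a ha x hx) (hX x (.inr (.inl hx)))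
      · exact hm.mem_bag .refl (hCD v hvC x hx) (hX x (.inr (.inr hx)))
    by_cases hbq : b ∈ S.bag q
    · obtain ⟨a', ha', haq⟩ := hfreeA q hXq
      exact .inl (inA q a' ha' (hm.mem_terr (hrun.step_right (hbA a' ha') haq) haq) hXq hbq)
    · obtain ⟨u, hu, huq⟩ := hfreeC q hXq
      refine .inr ⟨u, ?_, hu, hXq, hbq⟩
      rcases eq_or_ne v u with rfl | hne
      · exact hm.mem_terr .refl huq
      · exact hm.mem_terr (CanRun.step_right .refl (hC v hvC u hu hne) huq) huq
  obtain ⟨p, q, v, hvN, hv, hm, hXp, hXq, hNq⟩ :=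
    exists_clique_subset_bag hN hNX hv hvN hX
  have hXNq : ∀ x ∈ X ∪ (M ∪ D), x ∈ S.bag q := by
    rintro x (hx | hx)
    exacts [hXq x hx, hNq x hx]
  -- If `b` is already held when `N` is filled, the detour through `C` is unnecessary: the robber
  -- gets to `A` by way of `N'`.
  by_cases hb : b ∈ S.bag q
  · obtain ⟨w, hw, hwq⟩ := hfreeN q hXNq
    obtain ⟨a, ha, haq⟩ := hfreeA q hXNq
    exact inA q a ha (hm.mem_terr ((CanRun.step_right .refl (hNN' v hvN w hw) hwq).step_right
      (hN'A w hw a ha) haq) haq) hXNq hb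
  · obtain ⟨u, hu, huq⟩ := hfreeC q hXNq
    exact inC q u hu (hm.mem_terr (CanRun.step_right .refl (hNC v hvN u hu) huq) huq) hXNq hb

end Pursuit

/-! ### Vertices and edges of the digraphs `G_n(s,t)` -/

/-- The level of a vertex, with level `0` for the vertex `base`. -/
def Vertex.level : Vertex → ℕ
  | .base => 0
  | .M l _ => l
  | .D l _ => l
  | .C l _ _ => l
  | .A l _ => l
  | .B l _ => l

variable {s t : ℕ → ℕ} {n i : ℕ} {u v : Vertex}

theorem mem_setM : v ∈ setM s n ↔ ∃ j < n - s n, v = .M n j := by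
  simp [setM, eq_comm]

theorem mem_setD : v ∈ setD s n ↔ ∃ j < s n, v = .D n j := by
  simp [setD, eq_comm]

theorem mem_setN : v ∈ setN s n ↔ v ∈ setM s n ∨ v ∈ setD s n := by
  simp [setN]

theorem mem_setC : v ∈ setC s n i ↔ ∃ j < n - s n, v = .C n i j := by
  simp [setC, eq_comm]

theorem mem_setA : v ∈ setA s n ↔ ∃ j < s n, v = .A n j := by
  simp [setA, eq_comm]

theorem mem_setB : v ∈ setB t n ↔ ∃ j < t n, v = .B n j := by
  simp [setB, eq_comm]

theorem card_setM : (setM s n).card = n - s n := by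
  rw [setM, Finset.card_image_of_injective _ fun _ _ h => by injection h, Finset.card_range]

theorem card_setD : (setD s n).card = s n := by
  rw [setD, Finset.card_image_of_injective _ fun _ _ h => by injection h, Finset.card_range]

theorem card_setC : (setC s n i).card = n - s n := by
  rw [setC, Finset.card_image_of_injective _ fun _ _ h => by injection h, Finset.card_range]

theorem card_setA : (setA s n).card = s n := by
  rw [setA, Finset.card_image_of_injective _ fun _ _ h => by injection h, Finset.card_range]

theorem card_setB : (setB t n).card = t n := by
  rw [setB, Finset.card_image_of_injective _ fun _ _ h => by injection h, Finset.card_range]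

theorem disjoint_setM_setD : Disjoint (setM s n) (setD s n) := by
  simp only [Finset.disjoint_left, mem_setM, mem_setD]
  rintro _ ⟨j, -, rfl⟩ ⟨k, -, h⟩
  cases h

theorem card_setN (h : s n ≤ n) : (setN s n).card = n := by
  rw [setN, Finset.card_union_of_disjoint disjoint_setM_setD, card_setM, card_setD]
  omega

theorem vertices_of_lt (hn : n < 5) : vertices s t n = {.base} := by
  rw [vertices, if_pos hn]

theorem edges_of_lt (hn : n < 5) : edges s t n = ∅ := by
  rw [edges, if_pos hn]

theorem mem_vertices (hn : 5 ≤ n) : v ∈ vertices s t n ↔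
    v ∈ vertices s t (n - s n - 1) ∨ v ∈ setA s n ∨ v ∈ setB t n ∨
      (∃ i < t n, v ∈ setC s n i) ∨ v ∈ setM s n ∨ v ∈ setD s n := by
  rw [vertices, if_neg (by omega)]
  simp [setN]

theorem mem_edges (hn : 5 ≤ n) : (u, v) ∈ edges s t n ↔
    (u, v) ∈ edges s t (n - s n - 1) ∨
    (u ∈ setN s n ∧ v ∈ setN s n ∧ u ≠ v) ∨
    (∃ i < t n, u ∈ setC s n i ∧ v ∈ setC s n i ∧ u ≠ v) ∨
    (u ∈ setA s n ∧ v ∈ setA s n ∧ u ≠ v) ∨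
    (∃ i < t n, u ∈ setN s n ∧ v ∈ setC s n i) ∨
    (∃ i < t n, u ∈ setC s n i ∧ v ∈ setD s n) ∨
    (∃ i < t n, u ∈ setC s n i ∧ v = .B n i) ∨
    (u ∈ setB t n ∧ v ∈ setA s n) ∨
    (u ∈ setA s n ∧ v ∈ setB t n) ∨
    (u ∈ setA s n ∧ v ∈ setM s n) ∨
    (u ∈ setN s n ∧ v ∈ vertices s t (n - s n - 1)) ∨
    (u ∈ setA s n ∧ v ∈ vertices s t (n - s n - 1)) ∨
    (u ∈ vertices s t (n - s n - 1) ∧ v ∈ setA s n) ∨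
    (u ∈ vertices s t (n - s n - 1) ∧ v ∈ setB t n) := by
  rw [edges, if_neg (by omega)]
  simp only [Finset.mem_union, Finset.mem_biUnion, Finset.mem_range, Finset.mem_offDiag,
    Finset.mem_product, Finset.mem_singleton, and_or_left, exists_or, or_assoc]

theorem edge_vertices_setA (hn : 5 ≤ n) (hu : u ∈ vertices s t (n - s n - 1))
    (hv : v ∈ setA s n) : (u, v) ∈ edges s t n :=
  (mem_edges hn).2 (.inr (.inr (.inr (.inr (.inr (.inr (.inr (.inr (.inr (.inr (.inr (.inr (.inl ⟨hu, hv⟩)))))))))))))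

theorem edge_vertices_setB (hn : 5 ≤ n) (hu : u ∈ vertices s t (n - s n - 1))
    (hv : v ∈ setB t n) : (u, v) ∈ edges s t n :=
  (mem_edges hn).2 (.inr (.inr (.inr (.inr (.inr (.inr (.inr (.inr (.inr (.inr (.inr (.inr (.inr ⟨hu, hv⟩)))))))))))))

theorem edge_setN_vertices (hn : 5 ≤ n) (hu : u ∈ setN s n)
    (hv : v ∈ vertices s t (n - s n - 1)) : (u, v) ∈ edges s t n :=
  (mem_edges hn).2 (.inr (.inr (.inr (.inr (.inr (.inr (.inr (.inr (.inr (.inr (.inl ⟨hu, hv⟩)))))))))))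

theorem level_le (hv : v ∈ vertices s t n) : v.level ≤ n := by
  induction n using Nat.strong_induction_on with
  | _ n ih =>
    rcases lt_or_ge n 5 with hn | hn
    · rw [vertices_of_lt hn, Finset.mem_singleton] at hv
      simp [hv, Vertex.level]
    · rw [mem_vertices hn] at hv
      simp only [mem_setA, mem_setB, mem_setC, mem_setM, mem_setD] at hv
      rcases hv with h | ⟨j, -, rfl⟩ | ⟨j, -, rfl⟩ | ⟨i, -, j, -, rfl⟩ | ⟨j, -, rfl⟩ | ⟨j, -, rfl⟩
      · exact (ih _ (by omega) h).trans (by omega)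
      all_goals exact le_rfl

theorem level_lt (hn : 5 ≤ n) (hv : v ∈ vertices s t (n - s n - 1)) : v.level < n :=
  (level_le hv).trans_lt (by omega)

theorem mem_vertices_of_mem_edges (h : (u, v) ∈ edges s t n) :
    u ∈ vertices s t n ∧ v ∈ vertices s t n := by
  induction n using Nat.strong_induction_on with
  | _ n ih =>
    rcases lt_or_ge n 5 with hn | hn
    · simp [edges_of_lt hn] at h
    · rw [mem_edges hn] at h
      rw [mem_vertices hn, mem_vertices hn]
      simp only [mem_setN] at h
      have := ih (n - s n - 1) (by omega)
      have hB : ∀ i < t n, Vertex.B n i ∈ setB t n := fun i hi => mem_setB.2 ⟨i, hi, rfl⟩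
      grind

theorem edge_of_mem_setC (hn : 5 ≤ n) (h : (u, v) ∈ edges s t n) (hu : u ∈ setC s n i) :
    v ∈ setC s n i ∨ v ∈ setD s n ∨ v = .B n i := by
  obtain ⟨j, -, rfl⟩ := mem_setC.1 hu
  have h1 : Vertex.C n i j ∉ vertices s t (n - s n - 1) := fun h => (level_lt hn h).ne rfl
  have h2 : (Vertex.C n i j, v) ∉ edges s t (n - s n - 1) := fun h =>
    h1 (mem_vertices_of_mem_edges h).1
  simp [mem_edges hn, h1, h2, mem_setN, mem_setM, mem_setD, mem_setA, mem_setB, mem_setC] at h ⊢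
  rcases h with ⟨-, -, h, -⟩ | ⟨-, -, h⟩ | ⟨-, -, h⟩
  exacts [.inl h, .inr (.inl h), .inr (.inr h)]

theorem edge_of_mem_setB (hn : 5 ≤ n) (h : (u, v) ∈ edges s t n) (hu : u ∈ setB t n) :
    v ∈ setA s n := by
  obtain ⟨j, -, rfl⟩ := mem_setB.1 hu
  have h1 : Vertex.B n j ∉ vertices s t (n - s n - 1) := fun h => (level_lt hn h).ne rfl
  have h2 : (Vertex.B n j, v) ∉ edges s t (n - s n - 1) := fun h =>
    h1 (mem_vertices_of_mem_edges h).1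
  rw [mem_edges hn] at h
  simp [h1, h2, mem_setN, mem_setM, mem_setD, mem_setA, mem_setB, mem_setC] at h
  rw [mem_setA]
  grind

theorem edge_of_mem_setA (hn : 5 ≤ n) (h : (u, v) ∈ edges s t n) (hu : u ∈ setA s n) :
    v ∈ setA s n ∨ v ∈ setB t n ∨ v ∈ setM s n ∨ v ∈ vertices s t (n - s n - 1) := by
  obtain ⟨j, -, rfl⟩ := mem_setA.1 hu
  have h1 : Vertex.A n j ∉ vertices s t (n - s n - 1) := fun h => (level_lt hn h).ne rfl
  have h2 : (Vertex.A n j, v) ∉ edges s t (n - s n - 1) := fun h =>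
    h1 (mem_vertices_of_mem_edges h).1
  have h3 : Vertex.A n j ∉ setN s n := by simp [mem_setN, mem_setM, mem_setD]
  have h4 : ∀ i, Vertex.A n j ∉ setC s n i := by simp [mem_setC]
  have h5 : Vertex.A n j ∉ setB t n := by simp [mem_setB]
  simp only [mem_edges hn, h1, h2, h3, h4, h5, false_and, false_or, and_false, exists_false,
    or_false] at h
  tauto

theorem edge_of_mem_vertices (hn : 5 ≤ n) (h : (u, v) ∈ edges s t n)
    (hu : u ∈ vertices s t (n - s n - 1)) :
    (u, v) ∈ edges s t (n - s n - 1) ∨ v ∈ setA s n ∨ v ∈ setB t n := by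
  have hl := level_lt hn hu
  have h3 : u ∉ setN s n := by
    rw [mem_setN, mem_setM, mem_setD]
    rintro (⟨j, -, rfl⟩ | ⟨j, -, rfl⟩) <;> exact hl.ne rfl
  have h4 : ∀ i, u ∉ setC s n i := by
    intro i
    rw [mem_setC]
    rintro ⟨j, -, rfl⟩
    exact hl.ne rfl
  have h5 : u ∉ setB t n := by
    rw [mem_setB]
    rintro ⟨j, -, rfl⟩
    exact hl.ne rfl
  have h6 : u ∉ setA s n := by
    rw [mem_setA]
    rintro ⟨j, -, rfl⟩
    exact hl.ne rfl
  simp only [mem_edges hn, h3, h4, h5, h6, false_and, false_or, and_false, exists_false]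
    at h
  tauto

/-! ### An upper bound for the DAG-width of `G_n(s,t)` -/

/-- A set of vertices as a set of vertices of `G_n(s,t)`. -/
def bagOf (s t : ℕ → ℕ) (n : ℕ) (W : Finset Vertex) : Finset {v // v ∈ vertices s t n} :=
  W.subtype (· ∈ vertices s t n)

theorem mem_bagOf {s t : ℕ → ℕ} {n : ℕ} {W : Finset Vertex} {v : {v // v ∈ vertices s t n}} :
    v ∈ bagOf s t n W ↔ v.1 ∈ W := by
  simp [bagOf]

theorem card_bagOf_le {s t : ℕ → ℕ} {n : ℕ} {W : Finset Vertex} :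
    (bagOf s t n W).card ≤ W.card := by
  rw [bagOf, Finset.card_subtype]
  exact Finset.card_filter_le _ _

/-- The vertices of `Y` can be searched with `k` cops if the vertices of `X` are guarded. -/
def Searchable (s t : ℕ → ℕ) (n k : ℕ) (X Y : Finset Vertex) : Prop :=
  ∀ W : Finset Vertex, X ⊆ W → W.card ≤ k → (∀ v ∈ Y, v ∈ W → v ∈ X) →
    HasRootedDecomposition (graph s t n) k (bagOf s t n W) {v | v.1 ∈ W ∨ v.1 ∈ Y}

theorem Searchable.empty {s t : ℕ → ℕ} {n k : ℕ} : Searchable s t n k ∅ ∅ := by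
  intro W _ hW _
  convert HasRootedDecomposition.leaf (G := graph s t n) (card_bagOf_le.trans hW) using 1
  ext v
  simp [mem_bagOf]

/-- Every vertex of an inner copy has edges to all of the outer `B`, so these vertices remain to be
searched at the end. Each of them costs one additional cop, since its exits are in `X'` or `Y`; a
child for each `b` then continues with `Y`. Nonemptiness of `B` ensures that some child covers `Y`.
-/
theorem Searchable.union {s t : ℕ → ℕ} {n k : ℕ} {X X' Y B : Finset Vertex}
    (h : Searchable s t n k X Y) (hX : X ⊆ X') (hX' : X'.card + 1 ≤ k)
    (hY : ∀ u ∈ Y, ∀ v, (u, v) ∈ edges s t n → v ∈ X ∨ v ∈ Y)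
    (hB : ∀ u ∈ B, ∀ v, (u, v) ∈ edges s t n → v ∈ X' ∨ v ∈ Y)
    (hYX : ∀ v ∈ Y, v ∈ X' → v ∈ X) (hYB : ∀ v ∈ Y, v ∉ B) (hne : B.Nonempty) :
    Searchable s t n k X' (Y ∪ B) := by
  intro W hXW hW hYW
  have hchild (b : B) := h (insert b.1 X') (hX.trans (Finset.subset_insert _ _))
    ((Finset.card_insert_le _ _).trans hX') (by
      intro v hv hv'
      rcases Finset.mem_insert.1 hv' with rfl | hv'
      · exact (hYB _ hv b.2).elim
      · exact hYX v hv hv')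
  convert HasRootedDecomposition.join (card_bagOf_le.trans hW) hchild ?_ ?_ using 1
  · obtain ⟨b, hb⟩ := hne
    ext v
    simp only [Set.mem_ofPred_eq, mem_bagOf, Finset.mem_union, Finset.mem_insert, Subtype.exists]
    grind
  · rintro ⟨b, hb⟩ v hv hvW
    simp only [Set.mem_ofPred_eq, mem_bagOf, Finset.mem_insert, Finset.mem_union] at *
    grind
  · rintro ⟨b, hb⟩ u hu huW v huv
    simp only [Set.mem_ofPred_eq, mem_bagOf, Finset.mem_insert] at *
    have huv : (u.1, v.1) ∈ edges s t n := huv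
    grind

/-- The vertices of `G_n(s,t)` that are occupied first. -/
def core (s : ℕ → ℕ) (n : ℕ) : Finset Vertex := if n < 5 then {.base} else setN s n

set_option maxHeartbeats 1000000 in
-- The cops' strategy: `X` holds the guards of the outer levels and `Y` the outer `B`-vertices to
-- which the robber can still escape. Occupy `N`, then add `b_i` for an index `i` fitting the
-- robber's position. If he is in `C_i`, replace `M` by `C_i`: within the level, `C_i` leads only to
-- `D` and `b_i`. Otherwise replace `D` by `A`: from `A`, `B` and the inner copy, `D` cannot be
-- reached without passing `M`. Then release `M` and recurse. The step inward adds `s + 1` guards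
-- and lowers the index by `s + 1`, so the budget `k` persists.
theorem hasRootedDecomposition_vertices {s t : ℕ → ℕ} {n k : ℕ}
    (hs : ∀ l, 5 ≤ l → s l + 1 ≤ l) (ht : ∀ l, 5 ≤ l → 0 < t l) (m : ℕ) (X Y : Finset Vertex)
    (hV : ∀ u ∈ vertices s t m, ∀ v, (u, v) ∈ edges s t n →
      (u, v) ∈ edges s t m ∨ v ∈ X ∨ v ∈ Y)
    (hY : ∀ u ∈ Y, ∀ v, (u, v) ∈ edges s t n → v ∈ X ∨ v ∈ Y)
    (hYV : ∀ v ∈ Y, v ∉ vertices s t m)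
    (hXY : Searchable s t n k X Y) (hk : X.card + m + 1 ≤ k) :
    HasRootedDecomposition (graph s t n) k (bagOf s t n (X ∪ core s m))
      {v | v.1 ∈ X ∨ v.1 ∈ Y ∨ v.1 ∈ vertices s t m} := by
  induction m using Nat.strong_induction_on generalizing X Y with
  | _ m ih =>
    rcases lt_or_ge m 5 with hm | hm
    · rw [vertices_of_lt hm] at hYV ⊢
      rw [core, if_pos hm]
      convert hXY (X ∪ {.base}) Finset.subset_union_left
        ((Finset.card_union_le _ _).trans (by rw [Finset.card_singleton]; omega)) (by grind) using 1
      ext v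
      simp only [Set.mem_ofPred_eq, Finset.mem_union]
      tauto
    rw [core, if_neg (by omega)]
    have hsm := hs m hm
    have hVm := @mem_vertices s t m
    have hlt := fun v => @level_lt s t m v hm
    have hA : ∀ v ∈ setA s m, v.level = m := fun v hv => by
      obtain ⟨j, -, rfl⟩ := mem_setA.1 hv; rfl
    have hB : ∀ v ∈ setB t m, v.level = m := fun v hv => by
      obtain ⟨j, -, rfl⟩ := mem_setB.1 hv; rfl
    have hM : ∀ v ∈ setM s m, v.level = m := fun v hv => by
      obtain ⟨j, -, rfl⟩ := mem_setM.1 hv; rfl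
    have hD : ∀ v ∈ setD s m, v.level = m := fun v hv => by
      obtain ⟨j, -, rfl⟩ := mem_setD.1 hv; rfl
    have hMB : ∀ v ∈ setM s m, v ∉ setB t m := by
      simp +contextual [mem_setM, mem_setB]
    have hMC : ∀ i, ∀ v ∈ setM s m, v ∉ setC s m i := by
      simp +contextual [mem_setM, mem_setC]
    have hDA : ∀ v ∈ setD s m, v ∉ setA s m := by
      simp +contextual [mem_setD, mem_setA]
    have hDB : ∀ v ∈ setD s m, v ∉ setB t m := by
      simp +contextual [mem_setD, mem_setB]
    have hcard (U Z : Finset Vertex) (b : Vertex) :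
        (X ∪ U ∪ Z ∪ {b}).card ≤ X.card + U.card + Z.card + 1 := by
      have h1 := Finset.card_union_le (X ∪ U ∪ Z) {b}
      have h2 := Finset.card_union_le (X ∪ U) Z
      have h3 := Finset.card_union_le X U
      rw [Finset.card_singleton] at h1
      omega
    have hAV : ∀ v ∈ setA s m, v ∈ vertices s t m := fun v hv => (hVm hm).2 (by tauto)
    have hBV : ∀ v ∈ setB t m, v ∈ vertices s t m := fun v hv => (hVm hm).2 (by tauto)
    have hMV : ∀ v ∈ setM s m, v ∈ vertices s t m := fun v hv => (hVm hm).2 (by tauto)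
    have hDV : ∀ v ∈ setD s m, v ∈ vertices s t m := fun v hv => (hVm hm).2 (by tauto)
    have hCV : ∀ i < t m, ∀ v ∈ setC s m i, v ∈ vertices s t m := fun i hi v hv =>
      (hVm hm).2 (by grind)
    have hV'V : ∀ v ∈ vertices s t (m - s m - 1), v ∈ vertices s t m := fun v hv =>
      (hVm hm).2 (.inl hv)
    have hbB : ∀ i < t m, Vertex.B m i ∈ setB t m := fun i hi => mem_setB.2 ⟨i, hi, rfl⟩
    have hBedge : ∀ u ∈ setB t m, ∀ v, (u, v) ∈ edges s t n → v ∈ setA s m ∨ v ∈ X ∨ v ∈ Y :=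
      fun u hu v huv => (hV u (hBV u hu) v huv).imp_left fun h => edge_of_mem_setB hm h hu
    have hAedge : ∀ u ∈ setA s m, ∀ v, (u, v) ∈ edges s t n →
        (v ∈ setA s m ∨ v ∈ setB t m ∨ v ∈ setM s m ∨ v ∈ vertices s t (m - s m - 1)) ∨
          v ∈ X ∨ v ∈ Y :=
      fun u hu v huv => (hV u (hAV u hu) v huv).imp_left fun h => edge_of_mem_setA hm h hu
    have hCedge : ∀ i < t m, ∀ u ∈ setC s m i, ∀ v, (u, v) ∈ edges s t n →
        (v ∈ setC s m i ∨ v ∈ setD s m ∨ v = .B m i) ∨ v ∈ X ∨ v ∈ Y :=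
      fun i hi u hu v huv => (hV u (hCV i hi u hu) v huv).imp_left fun h =>
        edge_of_mem_setC hm h hu
    have hV'edge : ∀ u ∈ vertices s t (m - s m - 1), ∀ v, (u, v) ∈ edges s t n →
        ((u, v) ∈ edges s t (m - s m - 1) ∨ v ∈ setA s m ∨ v ∈ setB t m) ∨ v ∈ X ∨ v ∈ Y :=
      fun u hu v huv => (hV u (hV'V u hu) v huv).imp_left fun h => edge_of_mem_vertices hm h hu
    have hV'mem : ∀ u v, (u, v) ∈ edges s t (m - s m - 1) → v ∈ vertices s t (m - s m - 1) :=
      fun u v h => (mem_vertices_of_mem_edges h).2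
    have hT : ∀ i < t m, HasRootedDecomposition (graph s t n) k
        (bagOf s t n (X ∪ setM s m ∪ setA s m ∪ {.B m i}))
        {v | v.1 ∈ X ∨ v.1 ∈ setM s m ∨ v.1 ∈ setA s m ∨ v.1 ∈ setB t m ∨ v.1 ∈ Y ∨
          v.1 ∈ vertices s t (m - s m - 1)} := by
      intro i hi
      have hbi := hbB i hi
      have hX' : (X ∪ setA s m ∪ {.B m i}).card ≤ X.card + s m + 1 := by
        have := hcard ∅ (setA s m) (.B m i)
        rwa [Finset.union_empty, Finset.card_empty, card_setA] at this
      have hrec := ih (m - s m - 1) (by omega) (X ∪ setA s m ∪ {.B m i}) (Y ∪ setB t m)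
        (by grind) (by grind)
        (by
          intro v hv hv'
          rcases Finset.mem_union.1 hv with h | h
          · exact hYV v h (hV'V v hv')
          · exact (hlt v hv').ne (hB v h))
        (hXY.union (by grind) (by omega) hY (by grind) (by grind) (by grind) ⟨_, hbi⟩)
        (by omega)
      convert HasRootedDecomposition.join (card_bagOf_le.trans ((hcard (setM s m) (setA s m)
        (.B m i)).trans (by rw [card_setM, card_setA]; omega))) (fun _ : Unit => hrec) ?_ ?_ using 1
      · ext v
        simp only [Set.mem_ofPred_eq, mem_bagOf, Finset.mem_union, Finset.mem_singleton,
          exists_const]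
        grind
      · intro _ v hv hvW
        have := hlt v.1
        simp only [Set.mem_ofPred_eq, mem_bagOf, Finset.mem_union, Finset.mem_singleton] at hv hvW ⊢
        clear ih hXY hcard hrec
        grind
      · intro _ u hu huW v huv
        have huv : (u.1, v.1) ∈ edges s t n := huv
        simp only [Set.mem_ofPred_eq, mem_bagOf, Finset.mem_union, Finset.mem_singleton] at hu huW ⊢
        clear ih hXY hcard hrec
        grind
    have hC : ∀ i < t m, HasRootedDecomposition (graph s t n) k
        (bagOf s t n (X ∪ setD s m ∪ setC s m i ∪ {.B m i}))
        {v | v.1 ∈ X ∪ setD s m ∪ setC s m i ∪ {.B m i} ∨ v.1 ∈ Y} := fun i hi =>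
      hXY _ (by grind) ((hcard _ _ _).trans (by rw [card_setD, card_setC]; omega)) (by grind)
    have hNb : ∀ i < t m, HasRootedDecomposition (graph s t n) k
        (bagOf s t n (X ∪ setM s m ∪ setD s m ∪ {.B m i}))
        {v | v.1 ∈ X ∨ v.1 ∈ setM s m ∨ v.1 ∈ setD s m ∨ v.1 ∈ setC s m i ∨ v.1 ∈ setA s m ∨
          v.1 ∈ setB t m ∨ v.1 ∈ Y ∨ v.1 ∈ vertices s t (m - s m - 1)} := by
      intro i hi
      have hbi := hbB i hi
      convert HasRootedDecomposition.join₂ (card_bagOf_le.trans ((hcard (setM s m) (setD s m)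
        (.B m i)).trans (by rw [card_setM, card_setD]; omega))) (hC i hi) (hT i hi)
        ?_ ?_ ?_ ?_ using 1
      · clear ih hXY hC hT hcard
        ext v
        simp only [Set.mem_ofPred_eq, mem_bagOf, Finset.mem_union, Finset.mem_singleton]
        grind
      all_goals simp only [Set.mem_ofPred_eq, mem_bagOf, Finset.mem_union, Finset.mem_singleton]
      · clear ih hXY hC hT hcard
        intro v hv hvW
        have := hMC i v.1
        grind
      · clear ih hXY hC hT hcard
        intro v hv hvW
        have := hlt v.1
        grind
      · clear ih hXY hC hT hcard
        intro u hu huW v huv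
        have huv : (u.1, v.1) ∈ edges s t n := huv
        grind
      · clear ih hXY hC hT hcard
        intro u hu huW v huv
        have huv : (u.1, v.1) ∈ edges s t n := huv
        grind
    have hN : (X ∪ setN s m).card ≤ k :=
      (Finset.card_union_le _ _).trans (by rw [card_setN (by omega)]; omega)
    convert HasRootedDecomposition.join (card_bagOf_le.trans hN) (fun i : Fin (t m) =>
      hNb i i.2) ?_ ?_ using 1
    -- The children differ only in `C_i`, so child `0` covers everything else; this needs `t m` to
    -- be positive.
    · have h0 : 0 < t m := ht m hm
      ext v
      simp only [Set.mem_ofPred_eq, mem_bagOf, Finset.mem_union, mem_setN, hVm hm]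
      constructor
      · rintro (h | h | h | h | h | ⟨i, hi, h⟩ | h | h)
        exacts [.inl (.inl h), .inr ⟨⟨0, h0⟩, by simp [h]⟩, .inr ⟨⟨0, h0⟩, by simp [h]⟩,
          .inr ⟨⟨0, h0⟩, by simp [h]⟩, .inr ⟨⟨0, h0⟩, by simp [h]⟩, .inr ⟨⟨i, hi⟩, by simp [h]⟩,
          .inl (.inr (.inl h)), .inl (.inr (.inr h))]
      · rintro ((h | h | h) | ⟨i, h | h | h | h | h | h | h | h⟩)
        any_goals simp only [h, true_or, or_true]
        exact .inr (.inr (.inr (.inr (.inr (.inl ⟨i, i.2, h⟩)))))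
    all_goals simp only [Set.mem_ofPred_eq, mem_bagOf, Finset.mem_union, Finset.mem_singleton,
      mem_setN]
    · rintro ⟨i, hi⟩ v hv hvW
      tauto
    · clear ih hXY hC hT hNb hcard
      rintro ⟨i, hi⟩ u hu huW v huv
      have huv : (u.1, v.1) ∈ edges s t n := huv
      have := hbB i hi
      grind

theorem dagWidth_graph_le {s t : ℕ → ℕ} (hs : ∀ l, 5 ≤ l → s l + 1 ≤ l)
    (ht : ∀ l, 5 ≤ l → 0 < t l) (n : ℕ) : dagWidth (graph s t n) ≤ n + 1 := by
  have h := hasRootedDecomposition_vertices (k := n + 1) hs ht n ∅ ∅ (fun u _ v h => .inl h)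
    (by simp) (by simp) Searchable.empty (by simp)
  obtain ⟨D, hD⟩ := HasRootedDecomposition.exists_width_le (G := graph s t n) (k := n + 1)
    (W := bagOf s t n (∅ ∪ core s n)) (by
      convert h using 1
      ext v
      simp)
  exact (Nat.sInf_le (Set.mem_range_self D)).trans hD

/-! ### A lower bound for the size of DAG decompositions of `G_n(s,t)` -/

/-- The index of the copy of a smaller digraph `G_m(s,t)` that is nested at depth `j` in
`G_n(s,t)`. -/
def nestedIndex (s : ℕ → ℕ) (n : ℕ) : ℕ → ℕ
  | 0 => n
  | j + 1 => nestedIndex s n j - s (nestedIndex s n j) - 1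

/-- The vertices that are occupied when the robber enters the copy at depth `j`, for the given
choices of the vertices `b_i` at the outer levels. -/
def guards (s : ℕ → ℕ) (n : ℕ) (σ : ℕ → ℕ) : ℕ → Finset Vertex
  | 0 => ∅
  | j + 1 => guards s n σ j ∪ (setA s (nestedIndex s n j) ∪ {.B (nestedIndex s n j) (σ j)})

section nested

variable {s t : ℕ → ℕ} {n k j : ℕ} {σ : ℕ → ℕ} {u v x : Vertex}

theorem nestedIndex_lt (h5 : ∀ j < k, 5 ≤ nestedIndex s n j) {i : ℕ} (hij : i < j) (hj : j ≤ k) :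
    nestedIndex s n j < nestedIndex s n i := by
  induction j, hij using Nat.le_induction with
  | base =>
    have := h5 i (by omega)
    rw [nestedIndex]
    omega
  | succ j hij ih =>
    have := h5 j (by omega)
    have := ih (by omega)
    rw [nestedIndex]
    omega

theorem vertices_nestedIndex_subset (h5 : ∀ j < k, 5 ≤ nestedIndex s n j) (hj : j ≤ k) :
    vertices s t (nestedIndex s n j) ⊆ vertices s t n := by
  induction j with
  | zero => exact subset_rfl
  | succ j ih => exact fun v hv => ih (by omega) ((mem_vertices (h5 j hj)).2 (.inl hv))

theorem edges_nestedIndex_subset (h5 : ∀ j < k, 5 ≤ nestedIndex s n j) (hj : j ≤ k) :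
    edges s t (nestedIndex s n j) ⊆ edges s t n := by
  induction j with
  | zero => exact subset_rfl
  | succ j ih => exact fun ⟨u, v⟩ h => ih (by omega) ((mem_edges (h5 j hj)).2 (.inl h))

theorem mem_guards_succ : v ∈ guards s n σ (j + 1) ↔
    v ∈ guards s n σ j ∨ v ∈ setA s (nestedIndex s n j) ∨ v = .B (nestedIndex s n j) (σ j) := by
  simp only [guards, Finset.mem_union, Finset.mem_singleton]

theorem guards_subset_vertices (h5 : ∀ j < k, 5 ≤ nestedIndex s n j)
    (hσ : ∀ j < k, σ j < t (nestedIndex s n j)) (hj : j ≤ k) :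
    guards s n σ j ⊆ vertices s t n := by
  induction j with
  | zero => exact Finset.empty_subset _
  | succ j ih =>
    intro v hv
    rcases mem_guards_succ.1 hv with hv | hv | rfl
    · exact ih (by omega) hv
    · exact vertices_nestedIndex_subset h5 (by omega) ((mem_vertices (h5 j hj)).2 (by tauto))
    · exact vertices_nestedIndex_subset h5 (by omega) ((mem_vertices (h5 j hj)).2
        (.inr (.inr (.inl (mem_setB.2 ⟨_, hσ j hj, rfl⟩)))))

theorem lt_level_of_mem_guards (h5 : ∀ j < k, 5 ≤ nestedIndex s n j) (hj : j ≤ k)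
    (hv : v ∈ guards s n σ j) : nestedIndex s n j < v.level := by
  induction j with
  | zero => simp [guards] at hv
  | succ j ih =>
    have hlt := nestedIndex_lt h5 (Nat.lt_succ_self j) hj
    rcases mem_guards_succ.1 hv with hv | hv | rfl
    · exact hlt.trans (ih (by omega) hv)
    · obtain ⟨i, -, rfl⟩ := mem_setA.1 hv
      exact hlt
    · exact hlt

theorem disjoint_guards (h5 : ∀ j < k, 5 ≤ nestedIndex s n j) (hj : j ≤ k) :
    Disjoint (guards s n σ j) (vertices s t (nestedIndex s n j)) :=
  Finset.disjoint_left.2 fun _ hv hv' =>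
    (level_le hv').not_gt (lt_level_of_mem_guards h5 hj hv)

/-- Each level adds `s + 1` guards and lowers the index by the same amount. Hence the guards and the
innermost `N` together always number `n`, which leaves only `c + 1` spare places in a bag. -/
theorem card_guards (hs : ∀ l, 5 ≤ l → s l + 1 ≤ l) (h5 : ∀ j < k, 5 ≤ nestedIndex s n j)
    (hj : j ≤ k) : (guards s n σ j).card + nestedIndex s n j = n := by
  induction j with
  | zero => simp [guards, nestedIndex]
  | succ j ih =>
    have hlt := h5 j hj
    have h := hs _ hlt
    have hlevel : ∀ v ∈ guards s n σ j, v.level ≠ nestedIndex s n j :=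
      fun v hv => (lt_level_of_mem_guards h5 (by omega) hv).ne'
    rw [guards, Finset.card_union_of_disjoint, Finset.card_union_of_disjoint, card_setA,
      Finset.card_singleton, nestedIndex]
    · have := ih (by omega)
      omega
    · simp [mem_setA]
    · refine Finset.disjoint_left.2 fun v hv hv' => hlevel v hv ?_
      rcases Finset.mem_union.1 hv' with hv' | hv'
      · obtain ⟨i, -, rfl⟩ := mem_setA.1 hv'
        rfl
      · rw [Finset.mem_singleton.1 hv']
        rfl

theorem edge_to_guards (h5 : ∀ j < k, 5 ≤ nestedIndex s n j)
    (hσ : ∀ j < k, σ j < t (nestedIndex s n j)) (hj : j ≤ k)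
    (hu : u ∈ vertices s t (nestedIndex s n j)) (hx : x ∈ guards s n σ j) :
    (u, x) ∈ edges s t n := by
  induction j with
  | zero => simp [guards] at hx
  | succ j ih =>
    have h5j := h5 j hj
    rcases mem_guards_succ.1 hx with hx | hx | rfl
    · exact ih (by omega) ((mem_vertices h5j).2 (.inl hu)) hx
    · exact edges_nestedIndex_subset h5 (by omega) (edge_vertices_setA h5j hu hx)
    · have hB : Vertex.B (nestedIndex s n j) (σ j) ∈ setB t (nestedIndex s n j) :=
        mem_setB.2 ⟨_, hσ j hj, rfl⟩
      exact edges_nestedIndex_subset h5 (by omega) (edge_vertices_setB h5j hu hB)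

theorem B_mem_guards {l i : ℕ} :
    Vertex.B l i ∈ guards s n σ j ↔ ∃ j' < j, l = nestedIndex s n j' ∧ i = σ j' := by
  induction j with
  | zero => simp [guards]
  | succ j ih =>
    rw [mem_guards_succ, ih]
    simp only [mem_setA, reduceCtorEq, and_false, exists_false, false_or, Vertex.B.injEq]
    constructor
    · rintro (⟨j', hj', h⟩ | h)
      exacts [⟨j', by omega, h⟩, ⟨j, by omega, h⟩]
    · rintro ⟨j', hj', h⟩
      rcases Nat.lt_succ_iff_lt_or_eq.1 hj' with hj' | rfl
      exacts [.inl ⟨j', hj', h⟩, .inr h]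

end nested

theorem setM_subset_vertices {s t : ℕ → ℕ} {n : ℕ} (hn : 5 ≤ n) :
    setM s n ⊆ vertices s t n := fun _ hv => (mem_vertices hn).2 (by tauto)

theorem setA_subset_vertices {s t : ℕ → ℕ} {n : ℕ} (hn : 5 ≤ n) :
    setA s n ⊆ vertices s t n := fun _ hv => (mem_vertices hn).2 (by tauto)

theorem setN_subset_vertices {s t : ℕ → ℕ} {n : ℕ} (hn : 5 ≤ n) :
    setN s n ⊆ vertices s t n := fun _ hv => (mem_vertices hn).2 (by
      rw [mem_setN] at hv
      tauto)

theorem setC_subset_vertices {s t : ℕ → ℕ} {n i : ℕ} (hn : 5 ≤ n) (hi : i < t n) :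
    setC s n i ⊆ vertices s t n := fun _ hv => (mem_vertices hn).2
      (.inr (.inr (.inr (.inl ⟨i, hi, hv⟩))))

theorem card_le_card_of_forall_mem {s t : ℕ → ℕ} {n : ℕ} {Z : Finset Vertex}
    {W : Finset {v // v ∈ vertices s t n}} (hZ : Z ⊆ vertices s t n)
    (h : ∀ v : {v // v ∈ vertices s t n}, v.1 ∈ Z → v ∈ W) : Z.card ≤ W.card :=
  (Finset.card_le_card fun v hv => Finset.mem_image.2 ⟨⟨v, hZ hv⟩, h _ hv, rfl⟩).trans
    (Finset.card_image_le (f := Subtype.val))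

theorem exists_mem_notMem_of_card_lt {s t : ℕ → ℕ} {n : ℕ} {Z U : Finset Vertex}
    {W : Finset {v // v ∈ vertices s t n}} (hZ : Z ⊆ vertices s t n) (hU : U ⊆ vertices s t n)
    (hZU : Disjoint Z U) (h : ∀ v : {v // v ∈ vertices s t n}, v.1 ∈ Z → v ∈ W)
    (hW : W.card < Z.card + U.card) :
    ∃ u ∈ {v : {v // v ∈ vertices s t n} | v.1 ∈ U}, u ∉ W := by
  by_contra! hU'
  rw [← Finset.card_union_of_disjoint hZU] at hW
  refine hW.not_ge (card_le_card_of_forall_mem (Finset.union_subset hZ hU) fun v hv => ?_)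
  rcases Finset.mem_union.1 hv with hv | hv
  exacts [h v hv, hU' v hv]

/-! ### Forcing the guards, and counting the choices that share a bag -/

section pursuit

variable {s t : ℕ → ℕ} {n k c : ℕ} {σ : ℕ → ℕ}

/-- Both `X ∪ N` and `X ∪ M ∪ A` have exactly `n` vertices. When one of them is occupied, at most `c
+ 1` cops are left, too few to fill `C_i`, `A` or the next `N`; this provides the free vertices that
the robber's strategy needs. -/
theorem exists_position_nested {P : Type*} (S : Pursuit (graph s t n) P)
    (hS : ∀ p, (S.bag p).card ≤ n + 1 + c) (hinit : ∃ p, S.terr p = Set.univ)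
    (hs : ∀ l, 5 ≤ l → 2 * s l ≤ l) (h5 : ∀ j ≤ k, 5 ≤ nestedIndex s n j)
    (hc : ∀ j ≤ k, c + 1 < s (nestedIndex s n j))
    (hσ : ∀ j < k, σ j < t (nestedIndex s n j)) {j : ℕ} (hj : j ≤ k) :
    ∃ p, ∃ v ∈ S.terr p, v.1 ∈ setN s (nestedIndex s n j) ∧
      ∀ x, x.1 ∈ guards s n σ j → x ∈ S.bag p := by
  have h5' : ∀ j < k, 5 ≤ nestedIndex s n j := fun j hj => h5 j hj.le
  induction j with
  | zero =>
    obtain ⟨p, hp⟩ := hinit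
    have h5n : 5 ≤ n := h5 0 hj
    have hM : Vertex.M n 0 ∈ setN s n :=
      mem_setN.2 (.inl (mem_setM.2 ⟨0, by have := hs n h5n; omega, rfl⟩))
    refine ⟨p, ⟨Vertex.M n 0, setN_subset_vertices h5n hM⟩, hp ▸ Set.mem_univ _, hM, ?_⟩
    simp [guards]
  | succ j ih =>
    obtain ⟨p, v, hv, hvN, hp⟩ := ih (by omega)
    have hm := h5 j (by omega)
    have hm' := h5 (j + 1) hj
    have hsm := hs _ hm
    have hcm := hc j (by omega)
    have hcm' := hc (j + 1) hj
    have hsm' := hs _ hm'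
    have hV := vertices_nestedIndex_subset (t := t) h5' (show j ≤ k by omega)
    have hE := edges_nestedIndex_subset (t := t) h5' (show j ≤ k by omega)
    have hV' := vertices_nestedIndex_subset (t := t) h5' hj
    have hGV := guards_subset_vertices h5' hσ (show j ≤ k by omega)
    have hGd := disjoint_guards (σ := σ) (t := t) h5' (show j ≤ k by omega)
    have hGc := card_guards (σ := σ) (fun l hl => by have := hs l hl; omega) h5'
      (show j ≤ k by omega)
    have hGe := fun u x => edge_to_guards (u := u) (x := x) h5' hσ (show j ≤ k by omega)
    have hi := hσ j hj
    have hN'V := setN_subset_vertices (s := s) (t := t) hm'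
    have hnext : nestedIndex s n (j + 1) = nestedIndex s n j - s (nestedIndex s n j) - 1 := rfl
    set m := nestedIndex s n j with hmdef
    set m' := nestedIndex s n (j + 1) with hm'def
    set i := σ j with hidef
    set X := guards s n σ j with hX
    have hlt : m' < m := by omega
    have hMV := setM_subset_vertices (s := s) (t := t) hm
    have hNV := setN_subset_vertices (s := s) (t := t) hm
    have hAV := setA_subset_vertices (s := s) (t := t) hm
    have hCV := setC_subset_vertices (s := s) (t := t) hm hi
    have hN'V2 : setN s m' ⊆ vertices s t m := fun v hv =>
      (mem_vertices hm).2 (.inl (hnext ▸ hN'V hv))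
    have hBmem : Vertex.B m i ∈ setB t m := mem_setB.2 ⟨i, hi, rfl⟩
    have hBV : Vertex.B m i ∈ vertices s t m := (mem_vertices hm).2 (by tauto)
    have hcardN : (setN s m).card = m := card_setN (by omega)
    have hcardN' : (setN s m').card = m' := card_setN (by omega)
    have hedge : ∀ u v : {v // v ∈ vertices s t n}, (u.1, v.1) ∈ edges s t m →
        (graph s t n).Adj u v := fun u v h => hE h
    have hN'sub : ∀ v ∈ setN s m', v ∈ vertices s t (m - s m - 1) := fun v hv => hnext ▸ hN'V hv
    have hN'level : ∀ v ∈ setN s m', v.level ≠ m := fun v hv =>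
      ((level_le (hN'V hv)).trans_lt hlt).ne
    have hNC : Disjoint (setN s m) (setC s m i) := by
      simp only [Finset.disjoint_left, mem_setN, mem_setM, mem_setD, mem_setC]
      rintro v (⟨a, -, rfl⟩ | ⟨a, -, rfl⟩) ⟨b, -, h⟩ <;> cases h
    have hNA : Disjoint (setN s m) (setA s m) := by
      simp only [Finset.disjoint_left, mem_setN, mem_setM, mem_setD, mem_setA]
      rintro v (⟨a, -, rfl⟩ | ⟨a, -, rfl⟩) ⟨b, -, h⟩ <;> cases h
    have hNN' : Disjoint (setN s m) (setN s m') := by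
      refine Finset.disjoint_right.2 fun v hv hv' => hN'level v hv ?_
      simp only [mem_setN, mem_setM, mem_setD] at hv'
      rcases hv' with ⟨a, -, rfl⟩ | ⟨a, -, rfl⟩ <;> rfl
    have hAN' : Disjoint (setA s m) (setN s m') := by
      refine Finset.disjoint_right.2 fun v hv hv' => hN'level v hv ?_
      obtain ⟨a, -, rfl⟩ := mem_setA.1 hv'
      rfl
    have hMN : setM s m ⊆ setN s m := Finset.subset_union_left
    have hMA : Disjoint (setM s m) (setA s m) := hNA.mono_left hMN
    have hXN : (X ∪ setN s m).card = n := by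
      rw [Finset.card_union_of_disjoint (hGd.mono_right hNV), hcardN, hGc]
    have hXMA : (X ∪ (setM s m ∪ setA s m)).card = n := by
      rw [Finset.card_union_of_disjoint (hGd.mono_right (Finset.union_subset hMV hAV)),
        Finset.card_union_of_disjoint hMA, card_setM, card_setA, ← hGc]
      omega
    let T (U : Finset Vertex) : Set {v // v ∈ vertices s t n} := {v | v.1 ∈ U}
    have hXNT : ∀ {W : Finset {v // v ∈ vertices s t n}},
        (∀ x ∈ T X ∪ (T (setM s m) ∪ T (setD s m)), x ∈ W) →
        ∀ x : {v // v ∈ vertices s t n}, x.1 ∈ X ∪ setN s m → x ∈ W := by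
      intro W h x hx
      refine h x ?_
      rw [Finset.mem_union, mem_setN] at hx
      exact hx
    have hXMAT : ∀ {W : Finset {v // v ∈ vertices s t n}},
        (∀ x ∈ T X ∪ (T (setM s m) ∪ T (setA s m)), x ∈ W) →
        ∀ x : {v // v ∈ vertices s t n}, x.1 ∈ X ∪ (setM s m ∪ setA s m) → x ∈ W := by
      intro W h x hx
      refine h x ?_
      rw [Finset.mem_union, Finset.mem_union] at hx
      exact hx
    have hmemN : ∀ u ∈ T (setM s m) ∪ T (setD s m), u.1 ∈ setN s m := fun u hu =>
      mem_setN.2 hu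
    obtain ⟨q, w, hw, hwq, hqX, hqA, hqb⟩ := Pursuit.exists_next_level (S := S) (X := T X)
      (M := T (setM s m)) (D := T (setD s m)) (C := T (setC s m i)) (A := T (setA s m))
      (N' := T (setN s m')) (b := ⟨.B m i, hV hBV⟩)
      (fun u hu v hv huv => hedge u v ((mem_edges hm).2
        (.inr (.inl ⟨hmemN u hu, hmemN v hv, fun h => huv (Subtype.ext h)⟩))))
      (fun u hu v hv huv => hedge u v ((mem_edges hm).2
        (.inr (.inr (.inl ⟨i, hi, hu, hv, fun h => huv (Subtype.ext h)⟩)))))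
      (fun u hu v hv huv => hedge u v ((mem_edges hm).2
        (.inr (.inr (.inr (.inl ⟨hu, hv, fun h => huv (Subtype.ext h)⟩))))))
      (fun u hu v hv => hGe _ _ (hNV (hmemN u hu)) hv)
      (fun u hu v hv => hedge u v ((mem_edges hm).2
        (.inr (.inr (.inr (.inr (.inl ⟨i, hi, hmemN u hu, hv⟩)))))))
      (fun u hu v hv => hedge u v (edge_setN_vertices hm (hmemN u hu) (hN'sub _ hv)))
      (fun u hu v hv => hedge u v ((mem_edges hm).2
        (.inr (.inr (.inr (.inr (.inr (.inl ⟨i, hi, hu, hv⟩))))))))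
      (fun u hu => hedge u _ ((mem_edges hm).2
        (.inr (.inr (.inr (.inr (.inr (.inr (.inl ⟨i, hi, hu, rfl⟩)))))))))
      (fun u hu => hedge _ u ((mem_edges hm).2
        (.inr (.inr (.inr (.inr (.inr (.inr (.inr (.inl ⟨hBmem, hu⟩))))))))))
      (fun u hu v hv => hedge u v ((mem_edges hm).2
        (.inr (.inr (.inr (.inr (.inr (.inr (.inr (.inr (.inr (.inl ⟨hu, hv⟩))))))))))))
      (fun u hu v hv => hGe _ _ (hAV hu) hv)
      (fun u hu => hedge u _ ((mem_edges hm).2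
        (.inr (.inr (.inr (.inr (.inr (.inr (.inr (.inr (.inl ⟨hu, hBmem⟩)))))))))))
      (fun u hu v hv => hedge u v ((mem_edges hm).2 (.inr (.inr (.inr (.inr (.inr (.inr (.inr
        (.inr (.inr (.inr (.inr (.inl ⟨hu, hN'sub _ hv⟩))))))))))))))
      (fun u hu v hv => hedge u v (edge_vertices_setA hm (hN'sub _ hu) hv))
      (fun p hp => exists_mem_notMem_of_card_lt (Finset.union_subset hGV (hNV.trans hV))
        (hCV.trans hV) (Finset.disjoint_union_left.2 ⟨hGd.mono_right hCV, hNC⟩) (hXNT hp)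
        ((hS p).trans_lt (by rw [hXN, card_setC]; omega)))
      (fun p hp => exists_mem_notMem_of_card_lt (Finset.union_subset hGV (hNV.trans hV))
        (hAV.trans hV) (Finset.disjoint_union_left.2 ⟨hGd.mono_right hAV, hNA⟩) (hXNT hp)
        ((hS p).trans_lt (by rw [hXN, card_setA]; omega)))
      (fun p hp => exists_mem_notMem_of_card_lt (Finset.union_subset hGV (hNV.trans hV))
        (hN'V2.trans hV) (Finset.disjoint_union_left.2 ⟨hGd.mono_right hN'V2, hNN'⟩) (hXNT hp)
        ((hS p).trans_lt (by rw [hXN, hcardN']; omega)))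
      (fun p hp => exists_mem_notMem_of_card_lt (Finset.union_subset hGV
        ((Finset.union_subset hMV hAV).trans hV)) (hN'V2.trans hV)
        (Finset.disjoint_union_left.2 ⟨hGd.mono_right hN'V2,
          Finset.disjoint_union_left.2 ⟨hNN'.mono_left hMN, hAN'⟩⟩) (hXMAT hp)
        ((hS p).trans_lt (by rw [hXMA, hcardN']; omega)))
      hv (mem_setN.1 hvN) (fun x hx => hp x hx)
    refine ⟨q, w, hwq, hw, fun x hx => ?_⟩
    rcases mem_guards_succ.1 hx with hx | hx | hx
    · exact hqX x hx
    · exact hqA x hx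
    · have : x = ⟨.B m i, hV hBV⟩ := Subtype.ext hx
      rwa [this]

/-- In a DAG decomposition of width at most `n + 1 + c`, for each choice of vertices `b_i` on the
outer levels there is a bag that contains all of them. -/
theorem exists_node_guards (D : DAGDecomposition (graph s t n)) (hD : D.width ≤ n + 1 + c)
    (hs : ∀ l, 5 ≤ l → 2 * s l ≤ l) (h5 : ∀ j ≤ k, 5 ≤ nestedIndex s n j)
    (hc : ∀ j ≤ k, c + 1 < s (nestedIndex s n j))
    (hσ : ∀ j < k, σ j < t (nestedIndex s n j)) :
    ∃ d, ∀ x, x.1 ∈ guards s n σ k ∪ setN s (nestedIndex s n k) → x ∈ D.bag d := by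
  have h5' : ∀ j < k, 5 ≤ nestedIndex s n j := fun j hj => h5 j hj.le
  obtain ⟨p, v, hv, hvN, hp⟩ := exists_position_nested D.pursuit (c := c) (by
      rintro (_ | d)
      · simp [DAGDecomposition.pursuit]
      · exact (Finset.le_sup (f := fun d => (D.bag d).card) (Finset.mem_univ d)).trans hD)
    ⟨none, rfl⟩ hs h5 hc hσ le_rfl
  have hm := h5 k le_rfl
  have hNV := setN_subset_vertices (s := s) (t := t) hm
  obtain ⟨-, q, -, -, -, -, -, hqX, hqN⟩ := Pursuit.exists_clique_subset_bag
    (X := {x : {v // v ∈ vertices s t n} | x.1 ∈ guards s n σ k})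
    (N := {x : {v // v ∈ vertices s t n} | x.1 ∈ setN s (nestedIndex s n k)})
    (fun u hu v hv huv => edges_nestedIndex_subset h5' le_rfl ((mem_edges hm).2
      (.inr (.inl ⟨hu, hv, fun h => huv (Subtype.ext h)⟩))))
    (fun u hu x hx => edge_to_guards h5' hσ le_rfl (hNV hu) hx) hv hvN hp
  -- The initial position has an empty bag, whereas `N` is nonempty.
  rcases q with _ | d
  · exact (Finset.notMem_empty v (hqN v hvN)).elim
  · refine ⟨d, fun x hx => ?_⟩
    rcases Finset.mem_union.1 hx with hx | hx
    exacts [hqX x hx, hqN x hx]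

/-- If `σ` and `σ₀` are assigned the same bag, then every `b`-vertex where they differ is among the
at most `c + 1` vertices of the bag beyond the `n` forced by `σ₀`. So a fibre of the assignment has
at most `2 ^ (c + 1)` elements. -/
theorem pow_le_size (D : DAGDecomposition (graph s t n)) (hD : D.width ≤ n + 1 + c)
    (hs : ∀ l, 5 ≤ l → 2 * s l ≤ l) (h5 : ∀ j ≤ k, 5 ≤ nestedIndex s n j)
    (hc : ∀ j ≤ k, c + 1 < s (nestedIndex s n j)) {T : ℕ}
    (hT : ∀ j < k, T ≤ t (nestedIndex s n j)) : T ^ k ≤ 2 ^ (c + 1) * D.size := by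
  classical
  have h5' : ∀ j < k, 5 ≤ nestedIndex s n j := fun j hj => h5 j hj.le
  have hinj : ∀ i j : Fin k, nestedIndex s n i = nestedIndex s n j → i = j := by
    intro i j hij
    by_contra hne
    rcases lt_or_gt_of_ne (fun h => hne (Fin.ext h) : (i : ℕ) ≠ j) with h | h
    · exact (nestedIndex_lt h5' h j.2.le).ne hij.symm
    · exact (nestedIndex_lt h5' h i.2.le).ne hij
  -- Only levels below `k` matter, so the default `0` plays no role.
  let ext (σ : Fin k → Fin T) (j : ℕ) : ℕ := if h : j < k then σ ⟨j, h⟩ else 0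
  have hext : ∀ σ, ∀ j : Fin k, ext σ j = σ j := fun σ j => dif_pos j.2
  have hlt : ∀ σ, ∀ j < k, ext σ j < t (nestedIndex s n j) := fun σ j hj =>
    (hext σ ⟨j, hj⟩ ▸ (σ ⟨j, hj⟩).2 : ext σ j < T).trans_le (hT j hj)
  choose f hf using fun σ : Fin k → Fin T => exists_node_guards D hD hs h5 hc (hlt σ)
  have hcard := Finset.card_le_mul_card_image (f := f) Finset.univ (2 ^ (c + 1)) ?_
  · rw [Finset.card_univ, Fintype.card_fun, Fintype.card_fin, Fintype.card_fin] at hcard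
    exact hcard.trans (Nat.mul_le_mul_left _ (Finset.card_le_univ _))
  intro d hd
  obtain ⟨σ₀, -, hσ₀⟩ := Finset.mem_image.1 hd
  let b (σ : Fin k → Fin T) : Finset Vertex :=
    Finset.univ.image fun j : Fin k => .B (nestedIndex s n j) (σ j)
  have hmemb : ∀ σ (j : Fin k) i, Vertex.B (nestedIndex s n j) i ∈ b σ ↔ i = σ j := by
    intro σ j i
    simp only [b, Finset.mem_image, Finset.mem_univ, true_and, Vertex.B.injEq]
    constructor
    · rintro ⟨j', hj', rfl⟩
      rw [hinj _ _ hj']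
    · rintro rfl
      exact ⟨j, rfl, rfl⟩
  let Z := guards s n (ext σ₀) k ∪ setN s (nestedIndex s n k)
  let W := (D.bag d).image Subtype.val \ Z
  have hNV := setN_subset_vertices (s := s) (t := t) (h5 k le_rfl)
  have hZcard : Z.card = n := by
    rw [Finset.card_union_of_disjoint ((disjoint_guards h5' le_rfl).mono_right hNV),
      card_setN (by have := hs _ (h5 k le_rfl); omega)]
    exact card_guards (fun l hl => by have := hs l hl; omega) h5' le_rfl
  have hZsub : Z ⊆ (D.bag d).image Subtype.val := by
    intro v hv
    have hvV : v ∈ vertices s t n := (Finset.union_subset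
      (guards_subset_vertices h5' (hlt σ₀) le_rfl)
      (hNV.trans (vertices_nestedIndex_subset h5' le_rfl))) hv
    exact Finset.mem_image.2 ⟨⟨v, hvV⟩, hσ₀ ▸ hf σ₀ ⟨v, hvV⟩ hv, rfl⟩
  have hWcard : W.card ≤ c + 1 := by
    have h1 : (D.bag d).card ≤ n + 1 + c :=
      (Finset.le_sup (f := fun d => (D.bag d).card) (Finset.mem_univ d)).trans hD
    have h2 : ((D.bag d).image Subtype.val).card ≤ _ := Finset.card_image_le
    rw [Finset.card_sdiff_of_subset hZsub]
    omega
  -- Given `σ₀`, this difference determines `σ`: it names the new value at each level where they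
  -- differ, and contains nothing from the other levels.
  refine (Finset.card_le_card_of_injOn (t := W.powerset) (fun σ => b σ \ b σ₀) ?_ ?_).trans ?_
  · intro σ hσ
    have hσ : f σ = d := by simpa using hσ
    refine Finset.mem_coe.2 (Finset.mem_powerset.2 fun v hv => ?_)
    obtain ⟨hv, hv₀⟩ := Finset.mem_sdiff.1 hv
    obtain ⟨j, -, rfl⟩ := Finset.mem_image.1 hv
    have hvσ : Vertex.B (nestedIndex s n j) (σ j) ∈ guards s n (ext σ) k :=
      B_mem_guards.2 ⟨j, j.2, rfl, (hext σ j).symm⟩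
    have hvV := guards_subset_vertices h5' (hlt σ) le_rfl hvσ
    refine Finset.mem_sdiff.2 ⟨Finset.mem_image.2 ⟨⟨_, hvV⟩,
      hσ ▸ hf σ ⟨_, hvV⟩ (Finset.mem_union_left _ hvσ), rfl⟩, fun hvZ => ?_⟩
    rcases Finset.mem_union.1 hvZ with h | h
    · obtain ⟨j', hj', h1, h2⟩ := B_mem_guards.1 h
      obtain rfl : j = ⟨j', hj'⟩ := hinj _ _ h1
      exact hv₀ ((hmemb _ _ _).2 (h2.trans (hext σ₀ ⟨j', hj'⟩)))
    · simp [mem_setN, mem_setM, mem_setD] at h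
  · have key : ∀ σ σ' : Fin k → Fin T, b σ \ b σ₀ = b σ' \ b σ₀ → ∀ j, σ j ≠ σ₀ j →
        σ j = σ' j := by
      intro σ σ' h j hj
      have h1 : Vertex.B (nestedIndex s n j) (σ j) ∈ b σ \ b σ₀ := by
        rw [Finset.mem_sdiff, hmemb, hmemb]
        exact ⟨rfl, fun h => hj (Fin.ext h)⟩
      rw [h, Finset.mem_sdiff, hmemb] at h1
      exact Fin.ext h1.1
    intro σ _ σ' _ h
    funext j
    by_cases hj : σ j = σ₀ j
    · by_cases hj' : σ' j = σ₀ j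
      · rw [hj, hj']
      · exact (key σ' σ h.symm j hj').symm
    · exact key σ σ' h j hj
  · rw [Finset.card_powerset]
    exact Nat.pow_le_pow_right two_pos hWcard

end pursuit

/-! ### Asymptotics -/

theorem two_mul_levelParam_le {l : ℕ} (hl : 5 ≤ l) : 2 * levelParam l ≤ l := by
  have hl' : (4 : ℝ) ≤ l := by exact_mod_cast (by omega : 4 ≤ l)
  have hlog : 2 ≤ Real.logb 2 l := by
    rw [Real.le_logb_iff_rpow_le one_lt_two (by linarith)]
    norm_num
    omega
  have h : (levelParam l : ℝ) ≤ l / 2 :=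
    (Nat.floor_le (by positivity)).trans (by gcongr)
  have : ((2 * levelParam l : ℕ) : ℝ) ≤ l := by
    push_cast
    linarith
  exact_mod_cast this

theorem levelParam_pos {l : ℕ} (hl : 5 ≤ l) : 0 < levelParam l := by
  have hl' : (5 : ℝ) ≤ l := by exact_mod_cast hl
  have hlog : 0 < Real.logb 2 l := Real.logb_pos one_lt_two (by linarith)
  refine Nat.floor_pos.2 ((one_le_div hlog).2 ?_)
  rw [Real.logb_le_iff_le_rpow one_lt_two (by linarith), Real.rpow_natCast]
  exact_mod_cast Nat.lt_two_pow_self.le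

theorem eventually_mul_le_levelParam_sq (C : ℕ) :
    ∀ᶠ m : ℕ in Filter.atTop, C * m ≤ levelParam m ^ 2 := by
  -- The constant is chosen so that `m / log₂ m ≥ (C + 1) √m`. Rounding down loses at most `1 ≤ √m`,
  -- and squaring what remains gives `C² m ≥ C m`.
  have h := (isLittleO_log_rpow_atTop (r := 1 / 2) (by norm_num)).bound
    (c := Real.log 2 / (C + 1)) (by have := Real.log_pos one_lt_two; positivity)
  filter_upwards [tendsto_natCast_atTop_atTop.eventually h, Filter.eventually_ge_atTop 5]
    with m hm hm5
  have hm5' : (5 : ℝ) ≤ m := by exact_mod_cast hm5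
  have hlog2 := Real.log_pos one_lt_two
  have hlog : 0 < Real.log m := Real.log_pos (by linarith)
  rw [← Real.sqrt_eq_rpow, Real.norm_of_nonneg hlog.le, Real.norm_of_nonneg (Real.sqrt_nonneg _)]
    at hm
  have hsq : Real.sqrt m * Real.sqrt m = m := Real.mul_self_sqrt (by positivity)
  have hs1 : 1 ≤ Real.sqrt m := Real.one_le_sqrt.2 (by linarith)
  have h1 : (C + 1) * Real.sqrt m ≤ m / Real.logb 2 m := by
    rw [Real.logb, div_div_eq_mul_div, le_div_iff₀ hlog]
    have : (C + 1) * Real.sqrt m * Real.log m ≤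
        (C + 1) * Real.sqrt m * (Real.log 2 / (C + 1) * Real.sqrt m) := by gcongr
    refine this.trans_eq ?_
    rw [show (C + 1) * Real.sqrt m * (Real.log 2 / (C + 1) * Real.sqrt m) =
      Real.sqrt m * Real.sqrt m * Real.log 2 by field_simp, hsq]
  have h2 : (m : ℝ) / Real.logb 2 m < levelParam m + 1 := Nat.lt_floor_add_one _
  have h3 : C * Real.sqrt m ≤ levelParam m := by nlinarith
  have h4 : (C * Real.sqrt m) ^ 2 ≤ (levelParam m : ℝ) ^ 2 := by gcongr
  have h5 : ((C * m : ℕ) : ℝ) ≤ ((C ^ 2 * m : ℕ) : ℝ) := by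
    exact_mod_cast Nat.mul_le_mul_right m (Nat.le_self_pow two_ne_zero C)
  have h6 : ((C * m : ℕ) : ℝ) ≤ ((levelParam m ^ 2 : ℕ) : ℝ) := by
    refine h5.trans ?_
    push_cast
    rw [mul_pow, Real.sq_sqrt (by positivity)] at h4
    exact h4
  exact_mod_cast h6

theorem card_vertices_le {s t : ℕ → ℕ} (hs : ∀ l, 5 ≤ l → s l ≤ l) (ht : ∀ l, 5 ≤ l → t l ≤ l)
    (n : ℕ) : (vertices s t n).card ≤ n ^ 3 + 1 := by
  induction n using Nat.strong_induction_on with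
  | _ n ih =>
    rcases lt_or_ge n 5 with hn | hn
    · rw [vertices_of_lt hn, Finset.card_singleton]
      omega
    have hsn := hs n hn
    have htn := ht n hn
    have hC : ((Finset.range (t n)).biUnion fun i => setC s n i).card ≤ t n * (n - s n) := by
      have := Finset.card_biUnion_le_card_mul (Finset.range (t n)) (fun i => setC s n i) (n - s n)
        fun i _ => card_setC.le
      rwa [Finset.card_range] at this
    have hCn : t n * (n - s n) ≤ n * n := Nat.mul_le_mul htn (Nat.sub_le _ _)
    have hrec := ih (n - s n - 1) (by omega)
    have hpow : (n - s n - 1) ^ 3 ≤ (n - 1) ^ 3 := Nat.pow_le_pow_left (by omega) 3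
    -- One level adds at most `n * n` vertices in the `C_i` and at most `n` in each of `A`, `B` and
    -- `N`.
    have hpow' : (n - 1) ^ 3 + n * n + 3 * n ≤ n ^ 3 := by
      obtain ⟨m, rfl⟩ : ∃ m, n = m + 1 := ⟨n - 1, by omega⟩
      rw [Nat.add_sub_cancel]
      nlinarith
    rw [vertices, if_neg (by omega)]
    refine (Finset.card_union_le _ _).trans ?_
    have h1 := Finset.card_union_le (vertices s t (n - s n - 1) ∪ setA s n ∪ setB t n)
      ((Finset.range (t n)).biUnion fun i => setC s n i)
    have h2 := Finset.card_union_le (vertices s t (n - s n - 1) ∪ setA s n) (setB t n)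
    have h3 := Finset.card_union_le (vertices s t (n - s n - 1)) (setA s n)
    rw [card_setA] at h3
    rw [card_setB] at h2
    rw [card_setN hsn]
    omega

/-- For `m ≥ 6` one has `m - s m - 1 ≥ m / 2 - 1 ≥ m / 3`, so each level shrinks the index at most
by the factor `3`. -/
theorem le_three_pow_mul_nestedIndex {s : ℕ → ℕ} {n k m₀ : ℕ} (hs : ∀ l, 5 ≤ l → 2 * s l ≤ l)
    (hm₀ : 6 ≤ m₀) (hn : 3 ^ k * m₀ ≤ n) {j : ℕ} (hj : j ≤ k) :
    n ≤ 3 ^ j * nestedIndex s n j ∧ m₀ ≤ nestedIndex s n j := by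
  have key : ∀ m, j ≤ k → n ≤ 3 ^ j * m → m₀ ≤ m := by
    intro m hj h
    have h1 : 3 ^ j * m₀ ≤ 3 ^ k * m₀ :=
      Nat.mul_le_mul_right _ (Nat.pow_le_pow_right (by norm_num) hj)
    exact Nat.le_of_mul_le_mul_left ((h1.trans hn).trans h) (by positivity)
  suffices n ≤ 3 ^ j * nestedIndex s n j from ⟨this, key _ hj this⟩
  clear key
  induction j with
  | zero => simp [nestedIndex]
  | succ j ih =>
    have h := ih (by omega)
    have h1 : 3 ^ j * m₀ ≤ 3 ^ k * m₀ :=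
      Nat.mul_le_mul_right _ (Nat.pow_le_pow_right (by norm_num) (by omega))
    have h2 : m₀ ≤ nestedIndex s n j :=
      Nat.le_of_mul_le_mul_left ((h1.trans hn).trans h) (by positivity)
    have h3 := hs _ (by omega : 5 ≤ nestedIndex s n j)
    rw [pow_succ, mul_assoc, nestedIndex]
    exact h.trans (Nat.mul_le_mul_left _ (by omega))

theorem exists_eval_le (p : Polynomial ℝ) :
    ∃ C : ℕ, ∀ x : ℝ, 0 ≤ x → p.eval x ≤ C * (1 + x) ^ p.natDegree := by
  obtain ⟨C, hC⟩ := exists_nat_ge (∑ i ∈ Finset.range (p.natDegree + 1), |p.coeff i|)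
  refine ⟨C, fun x hx => ?_⟩
  rw [Polynomial.eval_eq_sum_range]
  calc ∑ i ∈ Finset.range (p.natDegree + 1), p.coeff i * x ^ i
      ≤ ∑ i ∈ Finset.range (p.natDegree + 1), |p.coeff i| * (1 + x) ^ p.natDegree := by
        refine Finset.sum_le_sum fun i hi => ?_
        have h1 : x ^ i ≤ (1 + x) ^ p.natDegree :=
          (pow_le_pow_left₀ hx (by linarith) i).trans
            (pow_le_pow_right₀ (by linarith) (Nat.lt_succ_iff.1 (Finset.mem_range.1 hi)))
        exact mul_le_mul (le_abs_self _) h1 (by positivity) (abs_nonneg _)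
    _ ≤ C * (1 + x) ^ p.natDegree := by
        rw [← Finset.sum_mul]
        gcongr

end DAGWidth

/-! ### The main theorem: choice of depth and threshold -/

theorem mainTheorem4 (c : ℕ) (p : Polynomial ℝ) :
    ∀ᶠ n : ℕ in Filter.atTop,
      ∀ D : DAGWidth.DAGDecomposition (DAGWidth.graph DAGWidth.levelParam DAGWidth.levelParam n),
        D.width ≤ DAGWidth.dagWidth (DAGWidth.graph DAGWidth.levelParam DAGWidth.levelParam n) + c →
          p.eval ((DAGWidth.vertices DAGWidth.levelParam DAGWidth.levelParam n).card : ℝ) <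
            (D.size : ℝ) := by
  open DAGWidth in
  obtain ⟨C, hC⟩ := exists_eval_le p
  set d := p.natDegree with hd
  -- With at least `√n` choices per level, this depth gives `n ^ (3 * d + 1)` choices. The value of
  -- `p` is at most `C * (3 * n ^ 3) ^ d`, so one factor `n` is left to absorb the constants,
  -- including `2 ^ (c + 1)`.
  set k := 2 * (3 * d + 1) with hk
  obtain ⟨m₀, hm₀⟩ := Filter.eventually_atTop.1 (eventually_mul_le_levelParam_sq (3 ^ k))
  -- A lower bound for the index at every depth up to `k`: `m₀` for the growth estimate, `6` for the
  -- factor `3` per level, and `(c + 2) ^ 2` to get `s > c + 1`.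
  set m₁ := m₀ + 6 + (c + 2) ^ 2 with hm₁
  filter_upwards [Filter.eventually_ge_atTop (3 ^ k * m₁),
    Filter.eventually_ge_atTop (2 ^ (c + 1) * (C * 3 ^ d) + 1)] with n hn hnC D hD
  have hs : ∀ l, 5 ≤ l → 2 * levelParam l ≤ l := fun l => two_mul_levelParam_le
  have hidx := fun j (hj : j ≤ k) =>
    le_three_pow_mul_nestedIndex (j := j) hs (by omega : 6 ≤ m₁) hn hj
  have hsq : ∀ j ≤ k, 3 ^ k * nestedIndex levelParam n j ≤
      levelParam (nestedIndex levelParam n j) ^ 2 := fun j hj =>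
    hm₀ _ (by have := (hidx j hj).2; omega)
  have hlarge : ∀ j ≤ k, c + 1 < levelParam (nestedIndex levelParam n j) := by
    intro j hj
    have h1 : (c + 2) ^ 2 ≤ levelParam (nestedIndex levelParam n j) ^ 2 :=
      (by have := (hidx j hj).2; omega : (c + 2) ^ 2 ≤ nestedIndex levelParam n j).trans
        ((Nat.le_mul_of_pos_left _ (by positivity)).trans (hsq j hj))
    have := (Nat.pow_le_pow_iff_left two_ne_zero).1 h1
    omega
  have hn1 : 1 ≤ n := by omega
  -- For `n ≥ 1` the left-hand side is the square root of `n` rounded up, so its square is at least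
  -- `n`.
  have hT : ∀ j < k, Nat.sqrt (n - 1) + 1 ≤ levelParam (nestedIndex levelParam n j) := by
    intro j hj
    have h1 : n ≤ levelParam (nestedIndex levelParam n j) ^ 2 :=
      (hidx j hj.le).1.trans ((Nat.mul_le_mul_right _
        (Nat.pow_le_pow_right (by norm_num) hj.le)).trans (hsq j hj.le))
    exact Nat.sqrt_lt'.2 (by omega)
  have hwidth : D.width ≤ n + 1 + c := hD.trans (Nat.add_le_add_right (dagWidth_graph_le
    (fun l hl => by have := hs l hl; omega) (fun l => levelParam_pos) n) c)
  have hsize := pow_le_size D hwidth hs (fun j hj => by have := (hidx j hj).2; omega) hlarge hT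
  have hpow : n ^ (3 * d + 1) ≤ 2 ^ (c + 1) * D.size := by
    refine le_trans ?_ hsize
    rw [hk, pow_mul]
    refine Nat.pow_le_pow_left ?_ _
    have := Nat.lt_succ_sqrt' (n - 1)
    rw [Nat.succ_eq_add_one] at this
    omega
  have hcard : (vertices levelParam levelParam n).card ≤ n ^ 3 + 1 :=
    card_vertices_le (fun l hl => by have := hs l hl; omega)
      (fun l hl => by have := hs l hl; omega) n
  have hn3 : 1 ≤ n ^ 3 := Nat.one_le_pow _ _ hn1
  have hnat : 2 ^ (c + 1) * (C * (1 + (vertices levelParam levelParam n).card) ^ d) <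
      2 ^ (c + 1) * D.size := by
    refine lt_of_lt_of_le ?_ hpow
    calc 2 ^ (c + 1) * (C * (1 + (vertices levelParam levelParam n).card) ^ d)
        ≤ 2 ^ (c + 1) * (C * (3 * n ^ 3) ^ d) := by gcongr; omega
      _ = 2 ^ (c + 1) * (C * 3 ^ d) * n ^ (3 * d) := by rw [mul_pow, ← pow_mul]; ring
      _ < n * n ^ (3 * d) := Nat.mul_lt_mul_of_pos_right (by omega) (by positivity)
      _ = n ^ (3 * d + 1) := by ring
  refine (hC _ (Nat.cast_nonneg _)).trans_lt ?_
  exact_mod_cast Nat.lt_of_mul_lt_mul_left hnat
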